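/- **Theorem (strong consistency of spectral clustering with local improvement in the soft geometric block model).** *Model.* Let $d\ge 0$ and $k\ge 2$ be fixed, let $\mathbf T^d=\mathbb R^d/\mathbb Z^d$ carry its uniform probability measure, and let $F_{in},F_{out}:\mathbf T^d\to[0,1]$ be measurable functions with $F_{in}(-x)=F_{in}(x)$ and $F_{out}(-x)=F_{out}(x)$ (as holds when they depend only on the distance of $x$ to $\mathbf 0$). For $z\in\mathbb Z^d$ write $\hat F(z)=\int_{\mathbf T^d}F(x)e^{-2\pi \mathrm i\langle z,x\rangle}dx$, and put $\mu_{in}=\int F_{in}$, $\mu_{out}=\int F_{out}$. For $n$ divisible by $k$ let $\sigma=\sigma_n:[n]\to[k]$ be an assignment with $k$ communities of size $n/k$ each. Choose $X_1,\dots,X_n$ independently and uniformly in $\mathbf T^d$ and, given these, let $G=G_n$ be the random graph on $[n]$ in which the pairs $i<j$ are edges independently, with probability $F_{in}(X_i-X_j)$ if $\sigma_i=\sigma_j$ and $F_{out}(X_i-X_j)$ otherwise. Let $A$ be the adjacency matrix of $G$. *Algorithm 1.* Let $\lambda_1'\ge\dots\ge\lambda_{k-1}'$ be the $k-1$ eigenvalues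 of $A$ (with multiplicity) closest to $\lambda_*=\frac{\mu_{in}-\mu_{out}}{k}n$, and let $V$ be the $n\times(k-1)$ matrix whose columns are orthonormal eigenvectors of $A$ for $\lambda'_1,\dots,\lambda'_{k-1}$. Apply $k$-means to the rows of $V$: for a fixed $\eta\ge 0$, find an $n\times k$ matrix $\hat P$ with entries in $\{0,1\}$ and exactly one $1$ in each row, and $\hat X\in\mathbb R^{k\times(k-1)}$, such that $\|\hat P\hat X-V\|_F^2\le(1+\eta)\min_{P,X}\|PX-V\|_F^2$, the minimum being over all such pairs. The output is the labelling $\tilde\sigma:[n]\to[k]$ for which $\tilde\sigma_i$ is the column of the $1$ in row $i$ of $\hat P$. *Algorithm 2.* Let $\tilde\sigma$ be the output of Algorithm 1. For each $i\in[n]$ let $\hat\sigma_i\in\arg\max_{\ell\in[k]}|\{j: ij\in E(G),\ \tilde\sigma_j=\ell\}|$. The output is $\hat\sigma$. *Loss.* Two labellings $[n]\to[k]$ are equivalent if they induce the same partition of $[n]$, and $\ell(\sigma,\hat\sigma)=\frac1n\min\{|\{i:\sigma_i\ne\sigma'_i\}|:\sigma'\text{ equivalent to }\hat\sigma\}$.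 *Theorem.* Assume that $\mu_{in}>\mu_{out}>0$, that $\hat F_{in}(z)+(k-1)\hat F_{out}(z)\ne\mu_{in}-\mu_{out}$ for all $z\in\mathbb Z^d$, and that $\hat F_{in}(z)-\hat F_{out}(z)\ne\mu_{in}-\mu_{out}$ for all $z\in\mathbb Z^d\setminus\{\mathbf 0\}$. Then, for every $\eta\ge0$ and every sequence of balanced assignments $\sigma_n$, Algorithm 2 is strongly consistent: as $n\to\infty$ through the multiples of $k$, the probability that some possible output $\hat\sigma$ of Algorithm 2 on $G_n$ (for any choice of eigenvectors, of the approximate $k$-means solution, and of the way ties are broken) has $\ell(\sigma_n,\hat\sigma)>0$ tends to $0$. -/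

import Mathlib

open MeasureTheory

noncomputable section

namespace SGBM

/-- The uniform probability measure on the flat torus `ℝ^d / ℤ^d`. -/
def torusMeasure (d : ℕ) : Measure (UnitAddTorus (Fin d)) :=
  Measure.pi fun _ => AddCircle.haarAddCircle

/-- Expected edge density `∫ F` of a connectivity probability function `F`. -/
def density {d : ℕ} (F : UnitAddTorus (Fin d) → ℝ) : ℝ :=
  ∫ x, F x ∂(torusMeasure d)

/-- Fourier coefficient `∫ F(x) exp(-2πi⟨z,x⟩) dx` of a real function on the torus. -/
def fourierCoeff {d : ℕ} (F : UnitAddTorus (Fin d) → ℝ) (z : Fin d → ℤ) : ℂ :=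
  ∫ x, (F x : ℂ) * UnitAddTorus.mFourier (-z) x ∂(torusMeasure d)

/-- Connection probability of two vertices with displacement `x` and labels `a`, `b`. -/
def connProb {d k : ℕ} (F_in F_out : UnitAddTorus (Fin d) → ℝ)
    (x : UnitAddTorus (Fin d)) (a b : Fin k) : ℝ :=
  if a = b then F_in x else F_out x

open Classical in
/-- Conditional probability of the graph `G`, given the positions `X` and the labels `σ`. -/
def condProb {d k n : ℕ} (F_in F_out : UnitAddTorus (Fin d) → ℝ) (σ : Fin n → Fin k)
    (X : Fin n → UnitAddTorus (Fin d)) (G : SimpleGraph (Fin n)) : ℝ :=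
  ∏ i : Fin n, ∏ j ∈ Finset.Ioi i,
    if G.Adj i j then connProb F_in F_out (X i - X j) (σ i) (σ j)
    else 1 - connProb F_in F_out (X i - X j) (σ i) (σ j)

/-- Law of the soft geometric block model on `n` vertices with labels `σ`: the positions are
independent and uniform on the torus, and given the positions the edges are independent. -/
def law {d k n : ℕ} (F_in F_out : UnitAddTorus (Fin d) → ℝ) (σ : Fin n → Fin k) :
    Measure (SimpleGraph (Fin n)) :=
  ∑ G : SimpleGraph (Fin n),
    ENNReal.ofReal (∫ X, condProb F_in F_out σ X G ∂(Measure.pi fun _ : Fin n => torusMeasure d)) •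
      Measure.dirac G

/-- All communities of the labelling have the same size `m`. -/
def Balanced {n k : ℕ} (m : ℕ) (σ : Fin n → Fin k) : Prop :=
  ∀ q : Fin k, (Finset.univ.filter fun i => σ i = q).card = m

/-- Two labellings are equivalent if they induce the same partition of the vertices. -/
def Equivalent {n k : ℕ} (σ τ : Fin n → Fin k) : Prop :=
  ∀ i j, σ i = σ j ↔ τ i = τ j

/-- Absolute classification error: the least Hamming distance from `σ` to a labelling that is
equivalent to `τ`. -/
def absError {n k : ℕ} (σ τ : Fin n → Fin k) : ℕ :=
  sInf {e : ℕ | ∃ τ' : Fin n → Fin k, Equivalent τ' τ ∧ e = hammingDist σ τ'}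

/-- Loss rate of the labelling `τ` as an estimate of `σ`. -/
def loss {n k : ℕ} (σ τ : Fin n → Fin k) : ℝ :=
  (absError σ τ : ℝ) / n

/-- `V` is an `n × r` matrix whose columns are orthonormal eigenvectors of the symmetric matrix `A`,
in decreasing order of their eigenvalues, and these are the `r` eigenvalues of `A` (with
multiplicity) closest to `c`. Ties are broken arbitrarily. -/
def IsClosestEigenvectors {n r : ℕ} (A : Matrix (Fin n) (Fin n) ℝ) (c : ℝ)
    (V : Matrix (Fin n) (Fin r) ℝ) : Prop :=
  ∃ (b : OrthonormalBasis (Fin n) ℝ (EuclideanSpace ℝ (Fin n))) (ev : Fin n → ℝ)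
    (e : Fin r ↪ Fin n),
    (∀ i, Matrix.toEuclideanLin A (b i) = ev i • b i) ∧
    Antitone (fun j => ev (e j)) ∧
    (∀ i, i ∉ Set.range e → ∀ j, |ev (e j) - c| ≤ |ev i - c|) ∧
    ∀ i j, V i j = b (e j) i

/-- The `n × k` membership matrix of a labelling: row `i` has its only `1` in column `τ i`. -/
def membership {n k : ℕ} (τ : Fin n → Fin k) : Matrix (Fin n) (Fin k) ℝ :=
  Matrix.of fun i l => if τ i = l then 1 else 0

/-- The `k`-means cost `‖P X - V‖²` (Frobenius norm) of the partition `τ` with membership matrix `P`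
and the centroids given by the rows of `X`. -/
def kmeansCost {n k r : ℕ} (V : Matrix (Fin n) (Fin r) ℝ) (τ : Fin n → Fin k)
    (X : Matrix (Fin k) (Fin r) ℝ) : ℝ :=
  ∑ i, ∑ j, (membership τ * X - V) i j ^ 2

/-- `τ` is the partition of a `(1 + η)`-approximate solution of the `k`-means problem for the rows
of `V`; for `η = 0` it is the partition of an optimal solution. -/
def IsApproxKMeans {n k r : ℕ} (η : ℝ) (V : Matrix (Fin n) (Fin r) ℝ) (τ : Fin n → Fin k) : Prop :=
  ∃ X : Matrix (Fin k) (Fin r) ℝ, ∀ (τ' : Fin n → Fin k) (X' : Matrix (Fin k) (Fin r) ℝ),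
    kmeansCost V τ X ≤ (1 + η) * kmeansCost V τ' X'

open Classical in
/-- `τ` is a possible output of spectral clustering on the graph `G`: embed the vertices by the
`k - 1` eigenvectors of the adjacency matrix for the eigenvalues closest to `(μin - μout) n / k`,
then apply (approximate) `k`-means. -/
def IsSpectralOutput {n k : ℕ} (η μin μout : ℝ) (G : SimpleGraph (Fin n))
    (τ : Fin n → Fin k) : Prop :=
  ∃ V : Matrix (Fin n) (Fin (k - 1)) ℝ,
    IsClosestEigenvectors (G.adjMatrix ℝ) ((μin - μout) / k * n) V ∧ IsApproxKMeans η V τ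

open Classical in
/-- Number of neighbours of `v` in `G` with label `l` under `τ`. -/
def labelledNeighbors {n k : ℕ} (G : SimpleGraph (Fin n)) (τ : Fin n → Fin k) (v : Fin n)
    (l : Fin k) : ℕ :=
  (Finset.univ.filter fun j => G.Adj v j ∧ τ j = l).card

/-- `τ'` is obtained from `τ` by giving each vertex a label that is most frequent, under `τ`, among
its neighbours. -/
def IsLocalImprovement {n k : ℕ} (G : SimpleGraph (Fin n)) (τ τ' : Fin n → Fin k) : Prop :=
  ∀ v l, labelledNeighbors G τ v l ≤ labelledNeighbors G τ v (τ' v)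

/-- `τ'` is a possible output of spectral clustering followed by local improvement. -/
def IsImprovedOutput {n k : ℕ} (η μin μout : ℝ) (G : SimpleGraph (Fin n))
    (τ' : Fin n → Fin k) : Prop :=
  ∃ τ : Fin n → Fin k, IsSpectralOutput η μin μout G τ ∧ IsLocalImprovement G τ τ'

end SGBM

end

noncomputable section

namespace SGBM

/-! Put Δ = μ_in − μ_out and n = km, so that the target eigenvalue is Δm. Given the positions, write
A = M + Z with M the conditional mean and Z the centred noise. The probabilistic part shows that,
for any ρ > 0 and all large m, the graph is regular (`IsRegular`) outside an event of probability at
most ρ; the rest is deterministic.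

Regularity has three sources. Noise: E‖Z²‖_F² ≤ 2n³ by a fourth moment count, and ‖Z‖⁴ ≤ ‖Z²‖_F², so
‖Z‖ ≤ νm. Positions: the displacements X_i − X_j to a fixed j are independent and uniform, so the
empirical Fourier coefficients of the connection functions concentrate, and M is close in Frobenius
norm to the kernel given by a Fourier series truncated to a finite set S; mean square convergence
suffices, so no smoothness is needed. Degrees: by Chernoff, every vertex has within εm of the
expected number of neighbours in every community.

Degree concentration makes each block vector u (constant on communities, with values summing to
zero) an approximate eigenvector: ‖Au − Δm u‖ ≤ kεm‖u‖. On the orthogonal complement of these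
vectors A − Δm is bounded below by νm (`le_norm_adjMatrix_sub_of_isRegular`). Indeed, if Aw ≈ Δm w,
then Mw ≈ Δm w; on the Fourier coefficients at z of the k community parts of w, M acts nearly as m
times the k × k matrix with diagonal F̂_in(z) and off-diagonal F̂_out(z). Its eigenvalues F̂_in +
(k−1)F̂_out and F̂_in − F̂_out avoid Δ by hypothesis, except the second at z = 0, where
orthogonality makes the k coefficients equal. So the coefficients in S are small, hence Mw is small,
a contradiction.

With ε much smaller than ν, the k−1 selected eigenvectors are therefore close to block vectors, and
the rows of V are close to k centres at squared distance at least 1/m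
(`exists_centres_of_isClosestEigenvectors`). Approximate k-means then mislabels only a small
fraction of the vertices, up to a permutation, and since the gap Δm between labelled degrees exceeds
the effect of these errors, one majority vote corrects every vertex. -/

instance torusMeasure_isAddHaarMeasure (d : ℕ) : (torusMeasure d).IsAddHaarMeasure :=
  inferInstanceAs (Measure.pi fun _ : Fin d => AddCircle.haarAddCircle (T := 1)).IsAddHaarMeasure

instance torusMeasure_isProbabilityMeasure (d : ℕ) : IsProbabilityMeasure (torusMeasure d) :=
  inferInstanceAs
    (IsProbabilityMeasure (Measure.pi fun _ : Fin d => AddCircle.haarAddCircle (T := 1)))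

/-! ### Displacements of independent uniform points on the torus -/

/-- The uniform measure on configurations of `n` points of the torus. -/
abbrev positionMeasure (d n : ℕ) : Measure (Fin n → UnitAddTorus (Fin d)) :=
  Measure.pi fun _ => torusMeasure d

/-- Replace every point but the `i`-th by its displacement to the `i`-th point. -/
def shear {d n : ℕ} (i : Fin n) :
    (Fin n → UnitAddTorus (Fin d)) →+ (Fin n → UnitAddTorus (Fin d)) where
  toFun X j := if j = i then X i else X j - X i
  map_zero' := by ext j; by_cases h : j = i <;> simp [h]
  map_add' X Y := by
    ext j
    by_cases h : j = i
    · simp [h]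
    · simp only [h, if_false, Pi.add_apply, Pi.sub_apply]
      abel

instance unitAddTorus_borelSpace (d : ℕ) : BorelSpace (UnitAddTorus (Fin d)) :=
  inferInstanceAs (BorelSpace (Fin d → UnitAddCircle))

instance unitAddTorus_secondCountableTopology (d : ℕ) :
    SecondCountableTopology (UnitAddTorus (Fin d)) :=
  inferInstanceAs (SecondCountableTopology (Fin d → UnitAddCircle))

instance positionMeasure_isAddHaarMeasure (d n : ℕ) : (positionMeasure d n).IsAddHaarMeasure :=
  Measure.pi.isAddHaarMeasure _

/-- The shear is a continuous surjective endomorphism of a compact group, and such a map preserves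
the Haar probability measure. -/
theorem measurePreserving_shear {d n : ℕ} (i : Fin n) :
    MeasurePreserving (shear (d := d) i) (positionMeasure d n) (positionMeasure d n) := by
  refine AddMonoidHom.measurePreserving ?_ ?_ rfl
  · refine continuous_pi fun j => ?_
    by_cases h : j = i
    · simpa [shear, h] using continuous_apply i
    · simp only [shear, h, if_false, AddMonoidHom.coe_mk, ZeroHom.coe_mk]
      exact (continuous_apply j).sub (continuous_apply i)
  · intro Y
    refine ⟨fun j => if j = i then Y i else Y j + Y i, ?_⟩
    ext j
    by_cases h : j = i <;> simp [shear, h]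

/-- The displacements to a fixed point are independent and uniform. -/
theorem integral_prod_displacement {𝕜 : Type*} [RCLike 𝕜] {d n : ℕ} (i : Fin n)
    (T : Finset (Fin n)) (hT : i ∉ T) (h : Fin n → UnitAddTorus (Fin d) → 𝕜)
    (hm : ∀ j, Measurable (h j)) :
    ∫ X, ∏ j ∈ T, h j (X j - X i) ∂positionMeasure d n =
      ∏ j ∈ T, ∫ x, h j x ∂torusMeasure d := by
  classical
  -- Fubini for independent coordinates, with the factor 1 outside `T`; pulling back along the shear
  -- turns the coordinates in `T` into displacements.
  have key := integral_fintype_prod_eq_prod (μ := fun _ : Fin n => torusMeasure d)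
    (fun j x => if j ∈ T then h j x else (1 : 𝕜))
  have hmeas : Measurable
      fun Y : Fin n → UnitAddTorus (Fin d) => ∏ j, if j ∈ T then h j (Y j) else (1 : 𝕜) := by
    refine Finset.measurable_prod _ fun j _ => ?_
    by_cases hj : j ∈ T
    · simp only [hj, if_true]
      exact (hm j).comp (measurable_pi_apply j)
    · simp [hj]
  have hmp := measurePreserving_shear (d := d) i
  change ∫ X, _ ∂positionMeasure d n = _ at key
  rw [← hmp.map_eq, integral_map hmp.measurable.aemeasurable
    hmeas.aestronglyMeasurable] at key
  have h1 : ∀ X : Fin n → UnitAddTorus (Fin d),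
      (∏ j, if j ∈ T then h j (shear i X j) else (1 : 𝕜)) = ∏ j ∈ T, h j (X j - X i) := by
    intro X
    rw [Finset.prod_ite_mem, Finset.univ_inter]
    refine Finset.prod_congr rfl fun j hj => ?_
    have : j ≠ i := fun e => hT (e ▸ hj)
    simp [shear, this]
  simp only [h1] at key
  rw [key]
  have h2 : ∀ j, ∫ x, (if j ∈ T then h j x else (1 : 𝕜)) ∂torusMeasure d =
      if j ∈ T then ∫ x, h j x ∂torusMeasure d else 1 := by
    intro j
    by_cases hj : j ∈ T <;> simp [hj]
  simp only [h2]
  rw [Finset.prod_ite_mem, Finset.univ_inter]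

theorem integral_displacement {𝕜 : Type*} [RCLike 𝕜] {d n : ℕ} {i j : Fin n} (hij : j ≠ i)
    (h : UnitAddTorus (Fin d) → 𝕜) (hm : Measurable h) :
    ∫ X, h (X j - X i) ∂positionMeasure d n = ∫ x, h x ∂torusMeasure d := by
  simpa using integral_prod_displacement i {j} (by simpa using hij.symm) (fun _ => h) fun _ => hm

theorem integral_displacement_mul {𝕜 : Type*} [RCLike 𝕜] {d n : ℕ} {i j l : Fin n} (hji : j ≠ i)
    (hli : l ≠ i) (hjl : j ≠ l) (f g : UnitAddTorus (Fin d) → 𝕜) (hf : Measurable f)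
    (hg : Measurable g) :
    ∫ X, f (X j - X i) * g (X l - X i) ∂positionMeasure d n =
      (∫ x, f x ∂torusMeasure d) * ∫ x, g x ∂torusMeasure d := by
  have := integral_prod_displacement (𝕜 := 𝕜) (d := d) i {j, l} (by simp [hji.symm, hli.symm])
    (fun t => if t = j then f else g) (fun t => by split_ifs <;> assumption)
  simpa [Finset.prod_pair hjl, hjl.symm] using this

/-- This lets the Dirac masses in `law` be evaluated on arbitrary sets of graphs. -/
instance simpleGraph_measurableSingletonClass (n : ℕ) :
    MeasurableSingletonClass (SimpleGraph (Fin n)) where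
  measurableSet_singleton G := by
    have h : ({G} : Set (SimpleGraph (Fin n))) =
        ⋂ u, ⋂ v, {H | H.Adj u v ↔ G.Adj u v} := by
      ext H
      simp only [Set.mem_singleton_iff, Set.mem_iInter, Set.mem_ofPred_eq]
      exact ⟨fun h => by simp [h], fun h => SimpleGraph.ext (by ext u v; exact h u v)⟩
    rw [h]
    refine MeasurableSet.iInter fun u => MeasurableSet.iInter fun v => ?_
    have := (SimpleGraph.measurable_iff_adj.1
      (measurable_id : Measurable (id : SimpleGraph (Fin n) → _)) u v)
    exact measurableSet_setOfPred.2 (by simpa using this.iff measurable_const)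

/-! ### From conditional to unconditional probabilities -/

section Law

variable {d k n : ℕ} {F_in F_out : UnitAddTorus (Fin d) → ℝ}

theorem measurable_connProb (h_in : Measurable F_in) (h_out : Measurable F_out) (a b : Fin k) :
    Measurable fun x => connProb F_in F_out x a b := by
  unfold connProb
  split_ifs <;> assumption

theorem connProb_mem (h_in : ∀ x, F_in x ∈ Set.Icc (0 : ℝ) 1)
    (h_out : ∀ x, F_out x ∈ Set.Icc (0 : ℝ) 1) (x : UnitAddTorus (Fin d)) (a b : Fin k) :
    connProb F_in F_out x a b ∈ Set.Icc (0 : ℝ) 1 := by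
  unfold connProb
  split_ifs
  · exact h_in x
  · exact h_out x

theorem connProb_symm (h_in : ∀ x, F_in (-x) = F_in x) (h_out : ∀ x, F_out (-x) = F_out x)
    (x y : UnitAddTorus (Fin d)) (a b : Fin k) :
    connProb F_in F_out (x - y) a b = connProb F_in F_out (y - x) b a := by
  unfold connProb
  rw [← neg_sub y x, h_in, h_out]
  simp [eq_comm]

theorem measurable_condProb (h_in : Measurable F_in) (h_out : Measurable F_out)
    (σ : Fin n → Fin k) (G : SimpleGraph (Fin n)) :
    Measurable fun X => condProb F_in F_out σ X G := by
  unfold condProb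
  refine Finset.measurable_prod _ fun i _ => Finset.measurable_prod _ fun j _ => ?_
  have := (measurable_connProb h_in h_out (σ i) (σ j)).comp
    ((measurable_pi_apply i).sub (measurable_pi_apply j) :
      Measurable fun X : Fin n → UnitAddTorus (Fin d) => X i - X j)
  split_ifs
  · exact this
  · exact measurable_const.sub this

open Classical in
theorem condProb_mem (h_in : ∀ x, F_in x ∈ Set.Icc (0 : ℝ) 1)
    (h_out : ∀ x, F_out x ∈ Set.Icc (0 : ℝ) 1) (σ : Fin n → Fin k)
    (X : Fin n → UnitAddTorus (Fin d)) (G : SimpleGraph (Fin n)) :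
    condProb F_in F_out σ X G ∈ Set.Icc (0 : ℝ) 1 := by
  have h : ∀ i j : Fin n, 0 ≤ connProb F_in F_out (X i - X j) (σ i) (σ j) ∧
      connProb F_in F_out (X i - X j) (σ i) (σ j) ≤ 1 :=
    fun i j => connProb_mem h_in h_out _ _ _
  unfold condProb
  constructor
  · refine Finset.prod_nonneg fun i _ => Finset.prod_nonneg fun j _ => ?_
    split_ifs
    · exact (h i j).1
    · linarith [(h i j).2]
  · have h0 : ∀ i j : Fin n, 0 ≤ (if G.Adj i j then connProb F_in F_out (X i - X j) (σ i) (σ j)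
        else 1 - connProb F_in F_out (X i - X j) (σ i) (σ j)) := by
      intro i j
      split_ifs
      · exact (h i j).1
      · linarith [(h i j).2]
    refine Finset.prod_le_one (fun i _ => Finset.prod_nonneg fun j _ => h0 i j)
      fun i _ => Finset.prod_le_one (fun j _ => h0 i j) fun j _ => ?_
    split_ifs
    · exact (h i j).2
    · linarith [(h i j).1]

/-- A bound for the conditional probability of an event given the positions gives a bound for its
probability. -/
theorem law_le_of_condProb_le (hm_in : Measurable F_in) (hm_out : Measurable F_out)
    (h_in : ∀ x, F_in x ∈ Set.Icc (0 : ℝ) 1)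
    (h_out : ∀ x, F_out x ∈ Set.Icc (0 : ℝ) 1) (σ : Fin n → Fin k)
    (S : Set (SimpleGraph (Fin n))) [DecidablePred (· ∈ S)]
    (Φ : (Fin n → UnitAddTorus (Fin d)) → ℝ)
    (hΦ : Integrable Φ (positionMeasure d n))
    (h : ∀ X, ∑ G with G ∈ S, condProb F_in F_out σ X G ≤ Φ X) :
    law F_in F_out σ S ≤ ENNReal.ofReal (∫ X, Φ X ∂positionMeasure d n) := by
  have hint : ∀ G, Integrable (fun X => condProb F_in F_out σ X G) (positionMeasure d n) := by
    intro G
    refine Integrable.of_bound (measurable_condProb hm_in hm_out σ G).aestronglyMeasurable 1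
      (Filter.Eventually.of_forall fun X => ?_)
    have := condProb_mem h_in h_out σ X G
    rw [Real.norm_of_nonneg this.1]
    exact this.2
  have hnn : ∀ G, 0 ≤ ∫ X, condProb F_in F_out σ X G ∂positionMeasure d n :=
    fun G => integral_nonneg fun X => (condProb_mem h_in h_out σ X G).1
  have h1 : law F_in F_out σ S = ENNReal.ofReal
      (∑ G with G ∈ S, ∫ X, condProb F_in F_out σ X G ∂positionMeasure d n) := by
    rw [ENNReal.ofReal_sum_of_nonneg fun G _ => hnn G, law, Measure.finsetSum_apply,
      Finset.sum_filter]
    refine Finset.sum_congr rfl fun G _ => ?_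
    rw [Measure.smul_apply, Measure.dirac_apply, smul_eq_mul]
    by_cases hG : G ∈ S <;> simp [hG]
  rw [h1, ← integral_finsetSum _ fun G _ => hint G]
  exact ENNReal.ofReal_le_ofReal
    (integral_mono (integrable_finsetSum _ fun G _ => hint G) hΦ h)

end Law

/-! ### Independent edges: factorisation and the moment bound for the noise -/

section GraphSums

variable {n : ℕ}

/-- The unordered pairs of distinct vertices. -/
def vertexPairs (n : ℕ) : Finset (Sym2 (Fin n)) :=
  Finset.univ.filter fun e => ¬ e.IsDiag

open Classical in
/-- A sum over all graphs of a product over all pairs of vertices factors. -/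
theorem sum_graph_prod_ite (a b : Sym2 (Fin n) → ℝ) :
    ∑ G : SimpleGraph (Fin n), ∏ e ∈ vertexPairs n, (if e ∈ G.edgeSet then a e else b e) =
      ∏ e ∈ vertexPairs n, (a e + b e) := by
  -- Expanding the product gives a sum over subsets of the set of pairs, and these subsets are
  -- exactly the edge sets of graphs.
  rw [Finset.prod_add]
  have hmem : ∀ t ∈ (vertexPairs n).powerset, ∀ e,
      e ∈ (SimpleGraph.fromEdgeSet (t : Set (Sym2 (Fin n)))).edgeSet ↔ e ∈ t := by
    intro t ht e
    rw [SimpleGraph.edgeSet_fromEdgeSet]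
    have ht' := Finset.mem_powerset.1 ht
    constructor
    · intro h
      simpa using h.1
    · intro h
      refine ⟨by simpa using h, ?_⟩
      have := (Finset.mem_filter.1 (ht' h)).2
      simpa using this
  refine Finset.sum_bij' (fun G _ => (vertexPairs n).filter (· ∈ G.edgeSet))
    (fun t _ => SimpleGraph.fromEdgeSet (t : Set (Sym2 (Fin n)))) ?_ ?_ ?_ ?_ ?_
  · intro G _
    simp
  · intro t _
    simp
  · intro G _
    rw [← SimpleGraph.edgeSet_inj]
    ext e
    rw [hmem _ (by simp)]
    simp only [vertexPairs, Finset.mem_filter, Finset.mem_univ, true_and, and_iff_right_iff_imp]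
    exact fun h => G.not_isDiag_of_mem_edgeSet h
  · intro t ht
    have h1 := hmem t ht
    generalize SimpleGraph.fromEdgeSet (t : Set (Sym2 (Fin n))) = H at h1
    ext e
    exact ⟨fun h => (h1 e).1 (Finset.mem_filter.1 h).2, fun h =>
      Finset.mem_filter.2 ⟨Finset.mem_powerset.1 ht h, (h1 e).2 h⟩⟩
  · intro G _
    rw [Finset.prod_ite, ← Finset.filter_not]

open Classical in
/-- The probability of `G` when the pairs `e` are edges independently with probabilities `p e`. -/
def graphWeight (p : Sym2 (Fin n) → ℝ) (G : SimpleGraph (Fin n)) : ℝ :=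
  ∏ e ∈ vertexPairs n, if e ∈ G.edgeSet then p e else 1 - p e

theorem graphWeight_nonneg {p : Sym2 (Fin n) → ℝ} (hp : ∀ e, p e ∈ Set.Icc (0 : ℝ) 1)
    (G : SimpleGraph (Fin n)) : 0 ≤ graphWeight p G := by
  refine Finset.prod_nonneg fun e _ => ?_
  split_ifs
  · exact (hp e).1
  · linarith [(hp e).2]

open Classical in
theorem sum_graphWeight_mul_prod (p a b : Sym2 (Fin n) → ℝ) :
    ∑ G, graphWeight p G * ∏ e ∈ vertexPairs n, (if e ∈ G.edgeSet then a e else b e) =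
      ∏ e ∈ vertexPairs n, (p e * a e + (1 - p e) * b e) := by
  rw [← sum_graph_prod_ite]
  refine Finset.sum_congr rfl fun G _ => ?_
  rw [graphWeight, ← Finset.prod_mul_distrib]
  refine Finset.prod_congr rfl fun e _ => ?_
  split_ifs <;> rfl

theorem sum_graphWeight (p : Sym2 (Fin n) → ℝ) : ∑ G, graphWeight p G = 1 := by
  classical
  simpa using sum_graphWeight_mul_prod p (fun _ => 1) fun _ => 1

/-- Markov's inequality for the conditional law of the graph. -/
theorem sum_graphWeight_filter_le {p : Sym2 (Fin n) → ℝ} (hp : ∀ e, p e ∈ Set.Icc (0 : ℝ) 1)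
    (S : SimpleGraph (Fin n) → Prop) [DecidablePred S]
    (Q : SimpleGraph (Fin n) → ℝ) (hQ : ∀ G, 0 ≤ Q G)
    (hS : ∀ G, S G → 1 ≤ Q G) :
    ∑ G with S G, graphWeight p G ≤ ∑ G, graphWeight p G * Q G := by
  rw [Finset.sum_filter]
  refine Finset.sum_le_sum fun G _ => ?_
  split_ifs with h
  · exact le_mul_of_one_le_right (graphWeight_nonneg hp G) (hS G h)
  · exact mul_nonneg (graphWeight_nonneg hp G) (hQ G)

open Classical in
/-- The centred indicator of the pair `e` being an edge. -/
def centredEdge (p : Sym2 (Fin n) → ℝ) (G : SimpleGraph (Fin n)) (e : Sym2 (Fin n)) : ℝ :=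
  if e ∈ vertexPairs n then (if e ∈ G.edgeSet then 1 else 0) - p e else 0

theorem abs_centredEdge_le {p : Sym2 (Fin n) → ℝ} (hp : ∀ e, p e ∈ Set.Icc (0 : ℝ) 1)
    (G : SimpleGraph (Fin n)) (e : Sym2 (Fin n)) : |centredEdge p G e| ≤ 1 := by
  have := hp e
  unfold centredEdge
  rw [abs_le]
  split_ifs <;> constructor <;> linarith [this.1, this.2]

/-- A product of centred edge indicators in which one of them occurs once has mean zero. -/
theorem sum_graphWeight_mul_prod_centredEdge {ι : Type*} [Fintype ι] (p : Sym2 (Fin n) → ℝ)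
    (E : ι → Sym2 (Fin n)) (t₀ : ι) (ht : ∀ t, t ≠ t₀ → E t ≠ E t₀) :
    ∑ G, graphWeight p G * ∏ t, centredEdge p G (E t) = 0 := by
  classical
  by_cases hE : ∀ t, E t ∈ vertexPairs n
  -- Regrouping the product by pairs `e` instead of indices `t` gives it the form to which the
  -- factorisation over independent edges applies.
  · have h1 : ∀ G, ∏ t, centredEdge p G (E t) = ∏ e ∈ vertexPairs n,
        if e ∈ G.edgeSet then ∏ t, (if e = E t then 1 - p e else 1)
        else ∏ t, (if e = E t then 0 - p e else 1) := by
      intro G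
      have h2 : ∀ t, centredEdge p G (E t) = ∏ e ∈ vertexPairs n,
          if e = E t then (if e ∈ G.edgeSet then 1 else 0) - p e else 1 := by
        intro t
        rw [Finset.prod_ite_eq' (vertexPairs n) (E t)
          (fun e => (if e ∈ G.edgeSet then (1 : ℝ) else 0) - p e), if_pos (hE t), centredEdge,
          if_pos (hE t)]
      simp only [h2]
      rw [Finset.prod_comm]
      refine Finset.prod_congr rfl fun e _ => ?_
      split_ifs <;> rfl
    simp only [h1]
    rw [sum_graphWeight_mul_prod]
    -- Only the index `t₀` contributes at the pair `E t₀`, whose factor is p(1 − p) + (1 − p)(0 − p)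
    -- = 0.
    refine Finset.prod_eq_zero (hE t₀) ?_
    have h3 : ∀ x : ℝ, ∏ t, (if E t₀ = E t then x else 1) = x := by
      intro x
      rw [Finset.prod_eq_single t₀ (fun t _ h => if_neg (ht t h).symm) (by simp)]
      simp
    rw [h3, h3]
    ring
  · push Not at hE
    obtain ⟨t, h⟩ := hE
    refine Finset.sum_eq_zero fun G _ => ?_
    rw [Finset.prod_eq_zero (Finset.mem_univ t) (by simp [centredEdge, h]), mul_zero]

/-- The expected squared Frobenius norm of the square of the centred adjacency matrix. -/
theorem sum_graphWeight_mul_noise_le {p : Sym2 (Fin n) → ℝ} (hp : ∀ e, p e ∈ Set.Icc (0 : ℝ) 1) :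
    ∑ G, graphWeight p G *
      ∑ i, ∑ l, (∑ j, centredEdge p G s(i, j) * centredEdge p G s(j, l)) ^ 2 ≤ 2 * (n : ℝ) ^ 3 := by
  classical
  have h1 : ∀ G, graphWeight p G *
      ∑ i, ∑ l, (∑ j, centredEdge p G s(i, j) * centredEdge p G s(j, l)) ^ 2 =
      ∑ i, ∑ l, ∑ j, ∑ q, graphWeight p G *
        ∏ t : Fin 4, centredEdge p G (![s(i, j), s(j, l), s(i, q), s(q, l)] t) := by
    intro G
    rw [Finset.mul_sum]
    simp only [Finset.mul_sum _ _ (graphWeight p G), Fin.prod_univ_four]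
    refine Finset.sum_congr rfl fun i _ => Finset.sum_congr rfl fun l _ => ?_
    rw [sq, Finset.sum_mul_sum, Finset.mul_sum]
    refine Finset.sum_congr rfl fun j _ => ?_
    rw [Finset.mul_sum]
    refine Finset.sum_congr rfl fun q _ => ?_
    simp only [Matrix.cons_val]
    ring
  simp only [h1]
  rw [Finset.sum_comm]
  -- For i ≠ l and j ≠ q, either one of the four pairs is degenerate or q ≠ i, and then {i, j}
  -- differs from the other three pairs, so the mean vanishes. The surviving terms are at most 1,
  -- and each of the two coincidences leaves n³ of them.
  have h2 : ∀ i l j q : Fin n, ∑ G, graphWeight p G *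
        ∏ t : Fin 4, centredEdge p G (![s(i, j), s(j, l), s(i, q), s(q, l)] t) ≤
      (if i = l then 1 else 0) + (if j = q then 1 else 0) := by
    intro i l j q
    have hle : ∑ G, graphWeight p G *
        ∏ t : Fin 4, centredEdge p G (![s(i, j), s(j, l), s(i, q), s(q, l)] t) ≤ 1 := by
      rw [← sum_graphWeight p]
      refine Finset.sum_le_sum fun G _ => mul_le_of_le_one_right (graphWeight_nonneg hp G) ?_
      refine (le_abs_self _).trans ?_
      rw [Finset.abs_prod]
      exact Finset.prod_le_one (fun _ _ => abs_nonneg _) fun _ _ => abs_centredEdge_le hp G _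
    by_cases hil : i = l
    · rw [if_pos hil]
      split_ifs
      all_goals linarith
    by_cases hjq : j = q
    · rw [if_pos hjq]
      split_ifs <;> linarith
    rw [if_neg hil, if_neg hjq]
    by_cases hjl : j = l ∨ i = j ∨ q = i ∨ q = l
    · refine le_of_eq ?_
      rw [add_zero]
      refine Finset.sum_eq_zero fun G _ => ?_
      have hd : ∀ v : Fin n, centredEdge p G s(v, v) = 0 := by
        intro v
        simp [centredEdge, vertexPairs]
      rw [Fin.prod_univ_four]
      rcases hjl with h | h | h | h <;> simp [h, hd]
    · push Not at hjl
      refine le_of_eq ?_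
      rw [add_zero]
      refine sum_graphWeight_mul_prod_centredEdge p _ 0 ?_
      intro t h0
      fin_cases t
      · exact absurd rfl h0
      · simp
        tauto
      · simp
        tauto
      · simp
        tauto
  calc _ = ∑ i, ∑ l, ∑ j, ∑ q, ∑ G, graphWeight p G *
        ∏ t : Fin 4, centredEdge p G (![s(i, j), s(j, l), s(i, q), s(q, l)] t) := by
        refine Finset.sum_congr rfl fun i _ => ?_
        rw [Finset.sum_comm]
        refine Finset.sum_congr rfl fun l _ => ?_
        rw [Finset.sum_comm]
        refine Finset.sum_congr rfl fun j _ => ?_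
        rw [Finset.sum_comm]
    _ ≤ ∑ i : Fin n, ∑ l : Fin n, ∑ j : Fin n, ∑ q : Fin n,
        ((if i = l then 1 else 0) + (if j = q then (1 : ℝ) else 0)) :=
        Finset.sum_le_sum fun i _ => Finset.sum_le_sum fun l _ => Finset.sum_le_sum fun j _ =>
          Finset.sum_le_sum fun q _ => h2 i l j q
    _ = 2 * (n : ℝ) ^ 3 := by
        simp [Finset.sum_add_distrib]
        ring

open Classical in
theorem condProb_eq_graphWeight {d k : ℕ} {F_in F_out : UnitAddTorus (Fin d) → ℝ}
    {σ : Fin n → Fin k} {X : Fin n → UnitAddTorus (Fin d)} {p : Sym2 (Fin n) → ℝ}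
    (hp : ∀ i j, p s(i, j) = connProb F_in F_out (X i - X j) (σ i) (σ j))
    (G : SimpleGraph (Fin n)) : condProb F_in F_out σ X G = graphWeight p G := by
  unfold condProb graphWeight
  simp only [← hp, ← SimpleGraph.mem_edgeSet]
  rw [Finset.prod_sigma']
  refine Finset.prod_bij' (fun q _ => s(q.1, q.2)) (fun e _ => ⟨e.inf, e.sup⟩) ?_ ?_ ?_ ?_ ?_
  · rintro ⟨i, j⟩ h
    simp only [Finset.mem_sigma, Finset.mem_univ, Finset.mem_Ioi, true_and] at h
    simp [vertexPairs, h.ne]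
  · intro e
    induction e with
    | _ i j =>
      intro h
      simp only [vertexPairs, Finset.mem_filter, Finset.mem_univ, true_and, Sym2.mk_isDiag_iff]
        at h
      simpa [eq_comm] using h
  · rintro ⟨i, j⟩ h
    simp only [Finset.mem_sigma, Finset.mem_univ, Finset.mem_Ioi, true_and] at h
    simp [h.le]
  · intro e
    induction e with
    | _ i j =>
      intro h
      rcases le_total i j with hij | hij <;> simp [hij, Sym2.eq_swap]
  · rintro ⟨i, j⟩ h
    rfl

end GraphSums

/-! ### Chernoff bounds for the labelled degrees -/

section Degrees

variable {d k n : ℕ} {F_in F_out : UnitAddTorus (Fin d) → ℝ}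

/-- The conditional probability of the edge `e` given the positions. -/
def edgeProb (F_in F_out : UnitAddTorus (Fin d) → ℝ) (σ : Fin n → Fin k)
    (X : Fin n → UnitAddTorus (Fin d)) (e : Sym2 (Fin n)) : ℝ :=
  connProb F_in F_out (X e.inf - X e.sup) (σ e.inf) (σ e.sup)

theorem edgeProb_mk (h_in : ∀ x, F_in (-x) = F_in x) (h_out : ∀ x, F_out (-x) = F_out x)
    (σ : Fin n → Fin k) (X : Fin n → UnitAddTorus (Fin d)) (i j : Fin n) :
    edgeProb F_in F_out σ X s(i, j) = connProb F_in F_out (X i - X j) (σ i) (σ j) := by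
  rcases le_total i j with h | h
  · simp [edgeProb, h]
  · simp only [edgeProb, Sym2.inf_mk, Sym2.sup_mk, h, inf_of_le_right, sup_of_le_left]
    exact connProb_symm h_in h_out _ _ _ _

theorem edgeProb_mem (h_in : ∀ x, F_in x ∈ Set.Icc (0 : ℝ) 1)
    (h_out : ∀ x, F_out x ∈ Set.Icc (0 : ℝ) 1) (σ : Fin n → Fin k)
    (X : Fin n → UnitAddTorus (Fin d)) (e : Sym2 (Fin n)) :
    edgeProb F_in F_out σ X e ∈ Set.Icc (0 : ℝ) 1 :=
  connProb_mem h_in h_out _ _ _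

/-- The mean connection probability of vertices with labels `a` and `b`. -/
def meanProb (F_in F_out : UnitAddTorus (Fin d) → ℝ) (a b : Fin k) : ℝ :=
  if a = b then density F_in else density F_out

theorem integral_connProb (a b : Fin k) :
    ∫ x, connProb F_in F_out x a b ∂torusMeasure d = meanProb F_in F_out a b := by
  unfold connProb meanProb density
  split_ifs <;> rfl

theorem integrable_connProb (hm_in : Measurable F_in) (hm_out : Measurable F_out)
    (h_in : ∀ x, F_in x ∈ Set.Icc (0 : ℝ) 1) (h_out : ∀ x, F_out x ∈ Set.Icc (0 : ℝ) 1)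
    (a b : Fin k) : Integrable (fun x => connProb F_in F_out x a b) (torusMeasure d) := by
  refine Integrable.of_bound (measurable_connProb hm_in hm_out a b).aestronglyMeasurable 1
    (Filter.Eventually.of_forall fun x => ?_)
  have := connProb_mem h_in h_out x a b
  rw [Real.norm_of_nonneg this.1]
  exact this.2

theorem density_mem {F : UnitAddTorus (Fin d) → ℝ} (h : ∀ x, F x ∈ Set.Icc (0 : ℝ) 1) :
    density F ∈ Set.Icc (0 : ℝ) 1 := by
  refine ⟨integral_nonneg fun x => (h x).1, ?_⟩
  have : density F ≤ ∫ _, (1 : ℝ) ∂torusMeasure d :=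
    integral_mono_of_nonneg (Filter.Eventually.of_forall fun x => (h x).1) (integrable_const _)
      (Filter.Eventually.of_forall fun x => (h x).2)
  simpa using this

theorem meanProb_mem (h_in : ∀ x, F_in x ∈ Set.Icc (0 : ℝ) 1)
    (h_out : ∀ x, F_out x ∈ Set.Icc (0 : ℝ) 1) (a b : Fin k) :
    meanProb F_in F_out a b ∈ Set.Icc (0 : ℝ) 1 := by
  unfold meanProb
  split_ifs
  · exact density_mem h_in
  · exact density_mem h_out

/-- The vertices with label `l`. -/
def community (σ : Fin n → Fin k) (l : Fin k) : Finset (Fin n) :=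
  Finset.univ.filter fun i => σ i = l

theorem mem_community {σ : Fin n → Fin k} {l : Fin k} {i : Fin n} :
    i ∈ community σ l ↔ σ i = l := by
  simp [community]

theorem labelledNeighbors_eq_card (G : SimpleGraph (Fin n)) (σ : Fin n → Fin k) (v : Fin n)
    (l : Fin k) : (labelledNeighbors G σ v l : ℝ) =
      ∑ j ∈ (community σ l).erase v, Set.indicator {j | G.Adj v j} 1 j := by
  classical
  unfold labelledNeighbors
  simp only [Set.indicator_apply, Set.mem_ofPred_eq, Pi.one_apply]
  rw [Finset.sum_boole]
  congr 2
  ext j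
  simp only [Finset.mem_filter, Finset.mem_univ, true_and, Finset.mem_erase, mem_community]
  exact ⟨fun h => ⟨⟨h.1.ne', h.2⟩, h.1⟩, fun h => ⟨h.2, h.1.2⟩⟩

/-- The conditional moment generating function of a labelled degree. -/
theorem sum_graphWeight_mul_exp_labelledNeighbors (p : Sym2 (Fin n) → ℝ) (σ : Fin n → Fin k)
    (v : Fin n) (l : Fin k) (s : ℝ) :
    ∑ G, graphWeight p G * Real.exp (s * labelledNeighbors G σ v l) =
      ∏ j ∈ (community σ l).erase v, (1 + p s(v, j) * (Real.exp s - 1)) := by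
  classical
  set T := (community σ l).erase v with hT
  have hinj : Set.InjOn (fun j => s(v, j)) (T : Set (Fin n)) := by
    intro i _ j _ h
    exact Sym2.congr_right.1 h
  have hsub : T.image (fun j => s(v, j)) ⊆ vertexPairs n := by
    intro e he
    obtain ⟨j, hj, rfl⟩ := Finset.mem_image.1 he
    have := (Finset.mem_erase.1 hj).1
    simp [vertexPairs, this.symm]
  have h1 : ∀ G : SimpleGraph (Fin n), Real.exp (s * labelledNeighbors G σ v l) =
      ∏ e ∈ vertexPairs n, if e ∈ G.edgeSet then
        (if e ∈ T.image (fun j => s(v, j)) then Real.exp s else 1) else 1 := by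
    intro G
    have h2 : ∀ e ∈ vertexPairs n, (if e ∈ G.edgeSet then
        (if e ∈ T.image (fun j => s(v, j)) then Real.exp s else 1) else 1) =
        if e ∈ T.image (fun j => s(v, j)) then (if e ∈ G.edgeSet then Real.exp s else 1)
          else 1 := by
      intro e _
      split_ifs <;> rfl
    rw [Finset.prod_congr rfl h2, Finset.prod_ite_mem, Finset.inter_eq_right.2 hsub,
      Finset.prod_image hinj, labelledNeighbors_eq_card, Finset.mul_sum, Real.exp_sum]
    refine Finset.prod_congr rfl fun j _ => ?_
    simp only [Set.indicator_apply, Set.mem_ofPred_eq, SimpleGraph.mem_edgeSet, Pi.one_apply]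
    split_ifs <;> simp
  simp only [h1]
  rw [sum_graphWeight_mul_prod]
  have h3 : ∀ e ∈ vertexPairs n, p e * (if e ∈ T.image (fun j => s(v, j)) then Real.exp s else 1) +
      (1 - p e) * 1 = if e ∈ T.image (fun j => s(v, j)) then 1 + p e * (Real.exp s - 1) else 1 := by
    intro e _
    split_ifs <;> ring
  rw [Finset.prod_congr rfl h3, Finset.prod_ite_mem, Finset.inter_eq_right.2 hsub,
    Finset.prod_image hinj]

/-- The Chernoff factor for the number of neighbours of `v` in community `l`. -/
def chernoffFactor (F_in F_out : UnitAddTorus (Fin d) → ℝ) (σ : Fin n → Fin k) (m : ℕ) (ε s : ℝ)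
    (v : Fin n) (l : Fin k) (X : Fin n → UnitAddTorus (Fin d)) : ℝ :=
  Real.exp (-(s * (m * meanProb F_in F_out l (σ v))) - |s| * (ε * m)) *
    ∏ j ∈ (community σ l).erase v,
      (1 + connProb F_in F_out (X j - X v) l (σ v) * (Real.exp s - 1))

/-- Relative to v the displacements are independent, so the factors integrate separately to 1 + μ(eˢ
− 1) ≤ exp(μ(eˢ − 1)). With eˢ − 1 − s ≤ s² and |s| = ε/2 the exponent is at most m(ε²/4 − ε²/2),
plus 1 for the possible absence of v from its own community. -/
theorem integral_chernoffFactor_le (hm_in : Measurable F_in) (hm_out : Measurable F_out)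
    (h_in : ∀ x, F_in x ∈ Set.Icc (0 : ℝ) 1) (h_out : ∀ x, F_out x ∈ Set.Icc (0 : ℝ) 1)
    {σ : Fin n → Fin k} {m : ℕ} (hσ : Balanced m σ) {ε s : ℝ} (hε1 : ε ≤ 1)
    (hs : |s| = ε / 2) (v : Fin n) (l : Fin k) :
    ∫ X, chernoffFactor F_in F_out σ m ε s v l X ∂positionMeasure d n ≤
      Real.exp (1 - m * (ε ^ 2 / 4)) := by
  unfold chernoffFactor
  rw [integral_const_mul, integral_prod_displacement v ((community σ l).erase v) (by simp)
    (fun _ x => 1 + connProb F_in F_out x l (σ v) * (Real.exp s - 1))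
    (fun _ => ((measurable_connProb hm_in hm_out l (σ v)).mul_const _).const_add 1)]
  have h1 : ∫ x, (1 + connProb F_in F_out x l (σ v) * (Real.exp s - 1)) ∂torusMeasure d =
      1 + meanProb F_in F_out l (σ v) * (Real.exp s - 1) := by
    rw [integral_add (integrable_const _)
      ((integrable_connProb hm_in hm_out h_in h_out l (σ v)).mul_const _), integral_mul_const,
      integral_connProb]
    simp
  simp only [h1]
  set μ := meanProb F_in F_out l (σ v)
  have hμ : 0 ≤ μ ∧ μ ≤ 1 := meanProb_mem h_in h_out l (σ v)
  rw [Finset.prod_const]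
  have hcard : (community σ l).card = m := hσ l
  have hM : (((community σ l).erase v).card : ℝ) ≤ m := by
    rw [← hcard]
    exact_mod_cast Finset.card_erase_le
  have hM' : (m : ℝ) ≤ ((community σ l).erase v).card + 1 := by
    have := Finset.pred_card_le_card_erase (s := community σ l) (a := v)
    rw [hcard] at this
    exact_mod_cast (by omega : m ≤ ((community σ l).erase v).card + 1)
  set M := ((community σ l).erase v).card
  have hs1 : |s| ≤ 1 := by rw [hs]; linarith
  have hexp : Real.exp s - 1 - s ≤ s ^ 2 := by
    have := Real.abs_exp_sub_one_sub_id_le hs1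
    exact (le_abs_self _).trans this
  have hexp0 : -1 ≤ Real.exp s - 1 := by linarith [Real.exp_pos s]
  have h2 : (1 + μ * (Real.exp s - 1)) ^ M ≤ Real.exp (M * (μ * (Real.exp s - 1))) := by
    rw [Real.exp_nat_mul]
    refine pow_le_pow_left₀ (by nlinarith) ?_ _
    linarith [Real.add_one_le_exp (μ * (Real.exp s - 1))]
  -- M is m or m − 1, since v is removed when it lies in community l; as μ(eˢ − 1) ≥ −1, replacing M
  -- by m costs at most 1.
  have h3 : M * (μ * (Real.exp s - 1)) ≤ m * (μ * (Real.exp s - 1)) + 1 := by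
    have : ((m : ℝ) - M) * (μ * (Real.exp s - 1)) ≥ -1 := by
      have ha : 0 ≤ (m : ℝ) - M := by linarith
      have hb : (m : ℝ) - M ≤ 1 := by linarith
      have hc : -1 ≤ μ * (Real.exp s - 1) := by nlinarith
      nlinarith
    linarith
  calc _ ≤ Real.exp (-(s * (m * μ)) - |s| * (ε * m)) * Real.exp (M * (μ * (Real.exp s - 1))) :=
        mul_le_mul_of_nonneg_left h2 (Real.exp_pos _).le
    _ = Real.exp (-(s * (m * μ)) - |s| * (ε * m) + M * (μ * (Real.exp s - 1))) :=
        (Real.exp_add _ _).symm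
    _ ≤ _ := by
        refine Real.exp_le_exp.2 ?_
        have h4 : μ * (Real.exp s - 1 - s) ≤ (ε / 2) ^ 2 := by
          rw [← hs, sq_abs]
          nlinarith [sq_nonneg s]
        have h5 := mul_le_mul_of_nonneg_left h4 (Nat.cast_nonneg (α := ℝ) m)
        rw [hs]
        nlinarith

theorem measurable_chernoffFactor (hm_in : Measurable F_in) (hm_out : Measurable F_out)
    (σ : Fin n → Fin k) (m : ℕ) (ε s : ℝ) (v : Fin n) (l : Fin k) :
    Measurable (chernoffFactor F_in F_out σ m ε s v l) := by
  unfold chernoffFactor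
  refine (Finset.measurable_prod _ fun j _ => Measurable.const_add
    (Measurable.mul_const ?_ _) 1).const_mul _
  exact (measurable_connProb hm_in hm_out l (σ v)).comp
    ((measurable_pi_apply j).sub (measurable_pi_apply v) :
      Measurable fun X : Fin n → UnitAddTorus (Fin d) => X j - X v)

theorem integrable_chernoffFactor (hm_in : Measurable F_in) (hm_out : Measurable F_out)
    (h_in : ∀ x, F_in x ∈ Set.Icc (0 : ℝ) 1) (h_out : ∀ x, F_out x ∈ Set.Icc (0 : ℝ) 1)
    (σ : Fin n → Fin k) (m : ℕ) (ε s : ℝ) (v : Fin n) (l : Fin k) :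
    Integrable (chernoffFactor F_in F_out σ m ε s v l) (positionMeasure d n) := by
  refine Integrable.of_bound
    (measurable_chernoffFactor hm_in hm_out σ m ε s v l).aestronglyMeasurable
    (Real.exp (-(s * (m * meanProb F_in F_out l (σ v))) - |s| * (ε * m)) *
      ∏ j ∈ (community σ l).erase v, (1 + |Real.exp s - 1|))
    (Filter.Eventually.of_forall fun X => ?_)
  rw [chernoffFactor, norm_mul, Real.norm_of_nonneg (Real.exp_pos _).le, norm_prod]
  refine mul_le_mul_of_nonneg_left (Finset.prod_le_prod (fun _ _ => norm_nonneg _) fun j _ => ?_)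
    (Real.exp_pos _).le
  refine (norm_add_le _ _).trans ?_
  rw [norm_one, norm_mul, Real.norm_eq_abs, Real.norm_eq_abs]
  have h := connProb_mem h_in h_out (X j - X v) l (σ v)
  rw [abs_of_nonneg h.1]
  have := mul_le_mul_of_nonneg_right h.2 (abs_nonneg (Real.exp s - 1))
  linarith

-- Exponential Markov at s = ±ε/2 and a union bound over v and l, for fixed positions. The centring
-- is at the unconditional mean, so the right side is not yet small for every X; it becomes small
-- only after integration over the positions.
open Classical in
theorem sum_graphWeight_degree_deviation_le (h_in : ∀ x, F_in x ∈ Set.Icc (0 : ℝ) 1)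
    (h_out : ∀ x, F_out x ∈ Set.Icc (0 : ℝ) 1)
    (he_in : ∀ x, F_in (-x) = F_in x) (he_out : ∀ x, F_out (-x) = F_out x)
    (σ : Fin n → Fin k) (m : ℕ) {ε : ℝ} (hε : 0 < ε) (X : Fin n → UnitAddTorus (Fin d)) :
    ∑ G with ∃ v l, ε * m < |(labelledNeighbors G σ v l : ℝ) - m * meanProb F_in F_out l (σ v)|,
        graphWeight (edgeProb F_in F_out σ X) G ≤
      ∑ v, ∑ l, (chernoffFactor F_in F_out σ m ε (ε / 2) v l X +
        chernoffFactor F_in F_out σ m ε (-(ε / 2)) v l X) := by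
  have hp := edgeProb_mem h_in h_out σ X
  have hmgf : ∀ (s : ℝ) (v : Fin n) (l : Fin k), chernoffFactor F_in F_out σ m ε s v l X =
      ∑ G, graphWeight (edgeProb F_in F_out σ X) G *
        Real.exp (s * ((labelledNeighbors G σ v l : ℝ) - m * meanProb F_in F_out l (σ v)) -
          |s| * (ε * m)) := by
    intro s v l
    have : ∏ j ∈ (community σ l).erase v,
        (1 + connProb F_in F_out (X j - X v) l (σ v) * (Real.exp s - 1)) =
        ∏ j ∈ (community σ l).erase v,
          (1 + edgeProb F_in F_out σ X s(v, j) * (Real.exp s - 1)) := by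
      refine Finset.prod_congr rfl fun j hj => ?_
      rw [Sym2.eq_swap, edgeProb_mk he_in he_out, mem_community.1 (Finset.mem_erase.1 hj).2]
    rw [chernoffFactor, this, ← sum_graphWeight_mul_exp_labelledNeighbors, Finset.mul_sum]
    refine Finset.sum_congr rfl fun G _ => ?_
    rw [mul_left_comm, ← Real.exp_add]
    ring_nf
  refine (sum_graphWeight_filter_le hp _ (fun G => ∑ v, ∑ l,
    (Real.exp (ε / 2 * ((labelledNeighbors G σ v l : ℝ) - m * meanProb F_in F_out l (σ v)) -
          |ε / 2| * (ε * m)) +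
     Real.exp (-(ε / 2) * ((labelledNeighbors G σ v l : ℝ) - m * meanProb F_in F_out l (σ v)) -
          |-(ε / 2)| * (ε * m)))) (fun G => by positivity) ?_).trans (le_of_eq ?_)
  · rintro G ⟨v, l, h⟩
    refine le_trans ?_ (Finset.single_le_sum (f := fun v => ∑ l, (Real.exp _ + Real.exp _))
      (fun v _ => by positivity) (Finset.mem_univ v))
    refine le_trans ?_ (Finset.single_le_sum (f := fun l => (Real.exp _ + Real.exp _))
      (fun l _ => by positivity) (Finset.mem_univ l))
    rw [abs_neg, abs_of_pos (half_pos hε)]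
    rcases lt_abs.1 h with h | h
    · refine le_trans (Real.one_le_exp ?_) (le_add_of_nonneg_right (Real.exp_pos _).le)
      nlinarith
    · refine le_trans (Real.one_le_exp ?_) (le_add_of_nonneg_left (Real.exp_pos _).le)
      nlinarith
  · simp only [hmgf, Finset.mul_sum, mul_add, ← Finset.sum_add_distrib]
    rw [Finset.sum_comm]
    refine Finset.sum_congr rfl fun v _ => ?_
    rw [Finset.sum_comm]

end Degrees

/-! ### Mean square convergence of Fourier series -/

section Fourier

variable {d : ℕ}

-- With this choice `volume` on the torus is definitionally `torusMeasure`, so the L² theory of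
-- `UnitAddTorus.mFourier` applies to it.
local instance unitAddCircle_measureSpace : MeasureSpace UnitAddCircle :=
  ⟨AddCircle.haarAddCircle⟩

local instance unitAddTorus_isFiniteMeasure :
    IsFiniteMeasure (volume : Measure (UnitAddTorus (Fin d))) :=
  inferInstanceAs (IsFiniteMeasure (torusMeasure d))

theorem fourierCoeff_eq_mFourierCoeff (F : UnitAddTorus (Fin d) → ℝ) (z : Fin d → ℤ) :
    fourierCoeff F z = UnitAddTorus.mFourierCoeff (fun x => (F x : ℂ)) z := by
  unfold fourierCoeff UnitAddTorus.mFourierCoeff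
  simp only [smul_eq_mul, mul_comm]
  rfl

/-- The partial sum over `S` of the Fourier series of `F`. -/
def fourierPartialSum (F : UnitAddTorus (Fin d) → ℝ) (S : Finset (Fin d → ℤ))
    (x : UnitAddTorus (Fin d)) : ℂ :=
  ∑ z ∈ S, fourierCoeff F z * UnitAddTorus.mFourier z x

theorem norm_mFourier_apply (z : Fin d → ℤ) (x : UnitAddTorus (Fin d)) :
    ‖UnitAddTorus.mFourier z x‖ = 1 := by
  simp only [UnitAddTorus.mFourier, ContinuousMap.coe_mk, norm_prod, fourier_apply,
    Circle.norm_coe, Finset.prod_const_one]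

/-- The Fourier series of a bounded function converges in mean square. -/
theorem eventually_integral_sq_fourierPartialSum_le {F : UnitAddTorus (Fin d) → ℝ}
    (hm : Measurable F) (hF : ∀ x, F x ∈ Set.Icc (0 : ℝ) 1) {ε : ℝ} (hε : 0 < ε) :
    ∀ᶠ S in Filter.atTop, ∫ x, ‖(F x : ℂ) - fourierPartialSum F S x‖ ^ 2 ∂torusMeasure d ≤ ε := by
  have hmem : MemLp (fun x => (F x : ℂ)) 2 (volume : Measure (UnitAddTorus (Fin d))) := by
    refine MemLp.of_bound (Complex.measurable_ofReal.comp hm).aestronglyMeasurable 1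
      (Filter.Eventually.of_forall fun x => ?_)
    rw [Complex.norm_real, Real.norm_of_nonneg (hF x).1]
    exact (hF x).2
  have hsum := UnitAddTorus.hasSum_mFourier_series_L2 hmem.toLp
  have hcoef : ∀ z, UnitAddTorus.mFourierCoeff (hmem.toLp : UnitAddTorus (Fin d) → ℂ) z =
      fourierCoeff F z := by
    intro z
    rw [fourierCoeff_eq_mFourierCoeff]
    refine integral_congr_ae ?_
    filter_upwards [hmem.coeFn_toLp] with x hx
    rw [hx]
  simp only [hcoef] at hsum
  have h1 := (Metric.tendsto_nhds.1 hsum) (Real.sqrt ε) (Real.sqrt_pos.2 hε)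
  filter_upwards [h1] with S hS
  set g : C(UnitAddTorus (Fin d), ℂ) := ∑ z ∈ S, fourierCoeff F z • UnitAddTorus.mFourier z with hg
  have hgsum : ∑ z ∈ S, fourierCoeff F z • UnitAddTorus.mFourierLp 2 z =
      ContinuousMap.toLp (E := ℂ) 2 volume ℂ g := by
    simp [hg, map_sum]
  rw [hgsum, dist_comm, dist_eq_norm] at hS
  have h2 : ∫ x, ‖(F x : ℂ) - fourierPartialSum F S x‖ ^ 2 ∂torusMeasure d =
      ‖hmem.toLp - ContinuousMap.toLp (E := ℂ) 2 volume ℂ g‖ ^ 2 := by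
    rw [← inner_self_eq_norm_sq (𝕜 := ℂ), L2.inner_def, ← integral_re (L2.integrable_inner _ _)]
    refine integral_congr_ae ?_
    filter_upwards [hmem.coeFn_toLp, ContinuousMap.coeFn_toLp (𝕜 := ℂ) (p := 2) volume g,
      Lp.coeFn_sub hmem.toLp (ContinuousMap.toLp (E := ℂ) 2 volume ℂ g)] with x hx hx' hx''
    rw [inner_self_eq_norm_sq, hx'', Pi.sub_apply, hx, hx', hg]
    simp [fourierPartialSum]
  rw [h2]
  calc _ ≤ Real.sqrt ε ^ 2 := pow_le_pow_left₀ (norm_nonneg _) hS.le 2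
    _ = ε := Real.sq_sqrt hε.le

theorem norm_fourierCoeff_le {F : UnitAddTorus (Fin d) → ℝ}
    (hF : ∀ x, F x ∈ Set.Icc (0 : ℝ) 1) (z : Fin d → ℤ) : ‖fourierCoeff F z‖ ≤ 1 := by
  refine (norm_integral_le_of_norm_le_const (C := 1)
    (Filter.Eventually.of_forall fun x => ?_)).trans (by simp)
  rw [norm_mul, norm_mFourier_apply, Complex.norm_real, Real.norm_of_nonneg (hF x).1, mul_one]
  exact (hF x).2

end Fourier

/-! ### Second moment estimates for the positions -/

section PositionStatistics

variable {d k n : ℕ} {F_in F_out : UnitAddTorus (Fin d) → ℝ}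

/-- A sum of centred bounded functions of the displacements to a fixed point has small variance. -/
theorem integral_norm_sq_sum_displacement_le {i : Fin n} {T : Finset (Fin n)} (hT : i ∉ T)
    {g : UnitAddTorus (Fin d) → ℂ} (hg : Measurable g) {C : ℝ} (hC : ∀ x, ‖g x‖ ≤ C)
    (h0 : ∫ x, g x ∂torusMeasure d = 0) :
    ∫ X, ‖∑ j ∈ T, g (X j - X i)‖ ^ 2 ∂positionMeasure d n ≤ T.card * C ^ 2 := by
  have hmeas : ∀ j, Measurable fun X : Fin n → UnitAddTorus (Fin d) => g (X j - X i) :=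
    fun j => hg.comp ((measurable_pi_apply j).sub (measurable_pi_apply i))
  have hC0 : 0 ≤ C := (norm_nonneg _).trans (hC 0)
  have hprod : ∀ j l, Integrable (fun X : Fin n → UnitAddTorus (Fin d) =>
      g (X j - X i) * (starRingEnd ℂ) (g (X l - X i))) (positionMeasure d n) := by
    intro j l
    refine Integrable.of_bound ((hmeas j).mul
      (Complex.continuous_conj.measurable.comp (hmeas l))).aestronglyMeasurable (C * C)
      (Filter.Eventually.of_forall fun X => ?_)
    rw [norm_mul, RCLike.norm_conj]
    exact mul_le_mul (hC _) (hC _) (norm_nonneg _) hC0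
  have key : ((∫ X, ‖∑ j ∈ T, g (X j - X i)‖ ^ 2 ∂positionMeasure d n : ℝ) : ℂ) =
      ∑ j ∈ T, ((∫ x, ‖g x‖ ^ 2 ∂torusMeasure d : ℝ) : ℂ) := by
    rw [← integral_complex_ofReal]
    have h1 : ∀ X : Fin n → UnitAddTorus (Fin d), ((‖∑ j ∈ T, g (X j - X i)‖ ^ 2 : ℝ) : ℂ) =
        ∑ j ∈ T, ∑ l ∈ T, g (X j - X i) * (starRingEnd ℂ) (g (X l - X i)) := by
      intro X
      rw [← Finset.sum_mul_sum, ← map_sum, Complex.mul_conj, Complex.normSq_eq_norm_sq]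
    simp only [h1]
    rw [integral_finsetSum _ fun j _ => integrable_finsetSum _ fun l _ => hprod j l]
    refine Finset.sum_congr rfl fun j hj => ?_
    have hji : j ≠ i := fun h => hT (h ▸ hj)
    rw [integral_finsetSum _ fun l _ => hprod j l, Finset.sum_eq_single j]
    · simp only [Complex.mul_conj, Complex.normSq_eq_norm_sq]
      rw [integral_complex_ofReal,
        integral_displacement hji (fun x => ‖g x‖ ^ 2) (hg.norm.pow_const 2)]
    -- Off-diagonal terms vanish: the two displacements are independent and `g` has mean zero.
    · intro l hl hlj
      have hli : l ≠ i := fun h => hT (h ▸ hl)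
      rw [integral_displacement_mul hji hli hlj.symm g (fun x => (starRingEnd ℂ) (g x)) hg
        (Complex.continuous_conj.measurable.comp hg), h0, zero_mul]
    · exact fun h => absurd hj h
  rw [← Complex.ofReal_sum, Complex.ofReal_inj] at key
  rw [key, Finset.sum_const, nsmul_eq_mul]
  refine mul_le_mul_of_nonneg_left ?_ (Nat.cast_nonneg _)
  have : ∫ x, ‖g x‖ ^ 2 ∂torusMeasure d ≤ ∫ _, C ^ 2 ∂torusMeasure d :=
    integral_mono_of_nonneg (Filter.Eventually.of_forall fun x => by positivity)
      (integrable_const _)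
      (Filter.Eventually.of_forall fun x => pow_le_pow_left₀ (norm_nonneg _) (hC x) 2)
  simpa using this

/-- The Fourier coefficients of the connection probability of labels `a` and `b`. -/
def connCoeff (F_in F_out : UnitAddTorus (Fin d) → ℝ) (z : Fin d → ℤ) (a b : Fin k) : ℂ :=
  if a = b then fourierCoeff F_in z else fourierCoeff F_out z

theorem norm_connCoeff_le (h_in : ∀ x, F_in x ∈ Set.Icc (0 : ℝ) 1)
    (h_out : ∀ x, F_out x ∈ Set.Icc (0 : ℝ) 1) (z : Fin d → ℤ) (a b : Fin k) :
    ‖connCoeff F_in F_out z a b‖ ≤ 1 := by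
  unfold connCoeff
  split_ifs
  · exact norm_fourierCoeff_le h_in z
  · exact norm_fourierCoeff_le h_out z

theorem integral_connProb_mul_mFourier (z : Fin d → ℤ) (a b : Fin k) :
    ∫ x, (connProb F_in F_out x a b : ℂ) * UnitAddTorus.mFourier (-z) x ∂torusMeasure d =
      connCoeff F_in F_out z a b := by
  unfold connProb connCoeff fourierCoeff
  split_ifs <;> rfl

/-- The truncated Fourier series of the connection probability of labels `a` and `b`. -/
def connSeries (F_in F_out : UnitAddTorus (Fin d) → ℝ) (S : Finset (Fin d → ℤ))
    (x : UnitAddTorus (Fin d)) (a b : Fin k) : ℂ :=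
  ∑ z ∈ S, connCoeff F_in F_out z a b * UnitAddTorus.mFourier z x

/-- The error of the empirical Fourier coefficient at `z` of the connection probabilities between
the vertex `j` and community `l`. -/
def coeffDeviation (F_in F_out : UnitAddTorus (Fin d) → ℝ) (σ : Fin n → Fin k) (m : ℕ)
    (X : Fin n → UnitAddTorus (Fin d)) (z : Fin d → ℤ) (l : Fin k) (j : Fin n) : ℂ :=
  ∑ i ∈ (community σ l).erase j, (connProb F_in F_out (X i - X j) l (σ j) : ℂ) *
    UnitAddTorus.mFourier (-z) (X i - X j) - m * connCoeff F_in F_out z l (σ j)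

theorem measurable_connProb_mul_mFourier (hm_in : Measurable F_in) (hm_out : Measurable F_out)
    (z : Fin d → ℤ) (a b : Fin k) :
    Measurable fun x => (connProb F_in F_out x a b : ℂ) * UnitAddTorus.mFourier (-z) x :=
  (Complex.measurable_ofReal.comp (measurable_connProb hm_in hm_out a b)).mul
    (UnitAddTorus.mFourier (-z)).continuous.measurable

theorem norm_connProb_mul_mFourier_le (h_in : ∀ x, F_in x ∈ Set.Icc (0 : ℝ) 1)
    (h_out : ∀ x, F_out x ∈ Set.Icc (0 : ℝ) 1) (z : Fin d → ℤ) (a b : Fin k)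
    (x : UnitAddTorus (Fin d)) :
    ‖(connProb F_in F_out x a b : ℂ) * UnitAddTorus.mFourier (-z) x‖ ≤ 1 := by
  have := connProb_mem h_in h_out x a b
  rw [norm_mul, norm_mFourier_apply, mul_one, Complex.norm_real, Real.norm_of_nonneg this.1]
  exact this.2

theorem integrable_norm_sq_coeffDeviation (hm_in : Measurable F_in) (hm_out : Measurable F_out)
    (h_in : ∀ x, F_in x ∈ Set.Icc (0 : ℝ) 1) (h_out : ∀ x, F_out x ∈ Set.Icc (0 : ℝ) 1)
    (σ : Fin n → Fin k) (m : ℕ) (z : Fin d → ℤ) (l : Fin k) (j : Fin n) :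
    Integrable (fun X => ‖coeffDeviation F_in F_out σ m X z l j‖ ^ 2) (positionMeasure d n) := by
  refine Integrable.of_bound (Measurable.aestronglyMeasurable ?_)
    ((((community σ l).erase j).card + m : ℝ) ^ 2)
    (Filter.Eventually.of_forall fun X => ?_)
  · refine (((Finset.measurable_sum _ fun i _ => ?_).sub_const _).norm).pow_const 2
    exact (measurable_connProb_mul_mFourier hm_in hm_out z l (σ j)).comp
      ((measurable_pi_apply i).sub (measurable_pi_apply j) :
        Measurable fun X : Fin n → UnitAddTorus (Fin d) => X i - X j)
  · rw [norm_pow, norm_norm]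
    refine pow_le_pow_left₀ (norm_nonneg _) ((norm_sub_le _ _).trans (add_le_add ?_ ?_)) 2
    · refine (norm_sum_le _ _).trans ((Finset.sum_le_sum fun i _ =>
        norm_connProb_mul_mFourier_le h_in h_out z l (σ j) _).trans ?_)
      simp
    · rw [norm_mul, Complex.norm_natCast]
      exact mul_le_of_le_one_right (Nat.cast_nonneg _) (norm_connCoeff_le h_in h_out _ _ _)

/-- The deviation is a sum of at most m centred terms of norm at most 2, up to an error of norm at
most 1 when j belongs to community l. Hence the bound 2 · 4m + 2, from (a + 1)² ≤ 2a² + 2. -/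
theorem integral_norm_sq_coeffDeviation_le (hm_in : Measurable F_in) (hm_out : Measurable F_out)
    (h_in : ∀ x, F_in x ∈ Set.Icc (0 : ℝ) 1) (h_out : ∀ x, F_out x ∈ Set.Icc (0 : ℝ) 1)
    {σ : Fin n → Fin k} {m : ℕ} (hσ : Balanced m σ) (z : Fin d → ℤ) (l : Fin k) (j : Fin n) :
    ∫ X, ‖coeffDeviation F_in F_out σ m X z l j‖ ^ 2 ∂positionMeasure d n ≤ 8 * m + 2 := by
  set c := connCoeff F_in F_out z l (σ j) with hc
  set T := (community σ l).erase j with hT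
  set g : UnitAddTorus (Fin d) → ℂ := fun x =>
    (connProb F_in F_out x l (σ j) : ℂ) * UnitAddTorus.mFourier (-z) x - c with hg
  have hcn : ‖c‖ ≤ 1 := norm_connCoeff_le h_in h_out _ _ _
  have hgm : Measurable g := (measurable_connProb_mul_mFourier hm_in hm_out z l (σ j)).sub_const c
  have hgb : ∀ x, ‖g x‖ ≤ 2 := fun x => (norm_sub_le _ _).trans
    (by linarith [norm_connProb_mul_mFourier_le h_in h_out z l (σ j) x])
  have hg0 : ∫ x, g x ∂torusMeasure d = 0 := by
    rw [hg, integral_sub, integral_connProb_mul_mFourier]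
    · simp [hc]
    · exact Integrable.of_bound
        (measurable_connProb_mul_mFourier hm_in hm_out z l (σ j)).aestronglyMeasurable 1
        (Filter.Eventually.of_forall fun x => norm_connProb_mul_mFourier_le h_in h_out z l (σ j) x)
    · exact integrable_const _
  have hvar := integral_norm_sq_sum_displacement_le (n := n) (T := T) (i := j) (by simp [hT])
    hgm hgb hg0
  have hcard : (community σ l).card = m := hσ l
  have hM : (T.card : ℝ) ≤ m := by
    rw [← hcard]
    exact_mod_cast Finset.card_erase_le
  have hM' : (m : ℝ) ≤ T.card + 1 := by
    have := Finset.pred_card_le_card_erase (s := community σ l) (a := j)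
    rw [hcard, ← hT] at this
    exact_mod_cast (by omega : m ≤ T.card + 1)
  have hle : ∀ X, ‖coeffDeviation F_in F_out σ m X z l j‖ ^ 2 ≤
      2 * ‖∑ i ∈ T, g (X i - X j)‖ ^ 2 + 2 := by
    intro X
    have h1 : coeffDeviation F_in F_out σ m X z l j =
        ∑ i ∈ T, g (X i - X j) - ((m - T.card : ℝ) : ℂ) * c := by
      simp only [coeffDeviation, hg, Finset.sum_sub_distrib, Finset.sum_const, nsmul_eq_mul]
      push_cast
      ring
    have h2 : ‖((m - T.card : ℝ) : ℂ) * c‖ ≤ 1 := by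
      rw [norm_mul, Complex.norm_real, Real.norm_of_nonneg (by linarith)]
      exact mul_le_one₀ (by linarith) (norm_nonneg _) hcn
    have h3 := norm_sub_le (∑ i ∈ T, g (X i - X j)) (((m - T.card : ℝ) : ℂ) * c)
    rw [← h1] at h3
    have h4 : ‖coeffDeviation F_in F_out σ m X z l j‖ ≤ ‖∑ i ∈ T, g (X i - X j)‖ + 1 := by
      linarith
    have h5 := pow_le_pow_left₀ (norm_nonneg _) h4 2
    nlinarith [sq_nonneg (‖∑ i ∈ T, g (X i - X j)‖ - 1)]
  have hint : Integrable (fun X : Fin n → UnitAddTorus (Fin d) =>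
      ‖∑ i ∈ T, g (X i - X j)‖ ^ 2) (positionMeasure d n) := by
    refine Integrable.of_bound (Measurable.aestronglyMeasurable
      ((Finset.measurable_sum _ fun i _ => hgm.comp
        ((measurable_pi_apply i).sub (measurable_pi_apply j))).norm.pow_const 2))
      ((T.card * 2 : ℝ) ^ 2) (Filter.Eventually.of_forall fun X => ?_)
    rw [norm_pow, norm_norm]
    refine pow_le_pow_left₀ (norm_nonneg _)
      ((norm_sum_le _ _).trans ((Finset.sum_le_sum fun i _ => hgb _).trans ?_)) 2
    simp
  calc _ ≤ ∫ X, (2 * ‖∑ i ∈ T, g (X i - X j)‖ ^ 2 + 2) ∂positionMeasure d n :=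
        integral_mono (integrable_norm_sq_coeffDeviation hm_in hm_out h_in h_out σ m z l j)
          ((hint.const_mul 2).add (integrable_const 2)) hle
    _ = 2 * ∫ X, ‖∑ i ∈ T, g (X i - X j)‖ ^ 2 ∂positionMeasure d n + 2 := by
        rw [integral_add (hint.const_mul 2) (integrable_const 2), integral_const_mul]
        simp
    _ ≤ 8 * m + 2 := by nlinarith

/-- The squared error of the truncated Fourier series at the displacement of `i` and `j`. -/
def seriesDeviation (F_in F_out : UnitAddTorus (Fin d) → ℝ) (σ : Fin n → Fin k)
    (S : Finset (Fin d → ℤ)) (X : Fin n → UnitAddTorus (Fin d)) (i j : Fin n) : ℝ :=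
  if i = j then 0 else
    ‖(connProb F_in F_out (X i - X j) (σ i) (σ j) : ℂ) -
      connSeries F_in F_out S (X i - X j) (σ i) (σ j)‖ ^ 2

theorem measurable_connProb_sub_connSeries (hm_in : Measurable F_in) (hm_out : Measurable F_out)
    (S : Finset (Fin d → ℤ)) (a b : Fin k) :
    Measurable fun x => ‖(connProb F_in F_out x a b : ℂ) - connSeries F_in F_out S x a b‖ ^ 2 :=
  (((Complex.measurable_ofReal.comp (measurable_connProb hm_in hm_out a b)).sub
    (Finset.measurable_sum _ fun z _ =>
      (UnitAddTorus.mFourier z).continuous.measurable.const_mul _)).norm).pow_const 2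

theorem norm_connSeries_le (h_in : ∀ x, F_in x ∈ Set.Icc (0 : ℝ) 1)
    (h_out : ∀ x, F_out x ∈ Set.Icc (0 : ℝ) 1) (S : Finset (Fin d → ℤ))
    (x : UnitAddTorus (Fin d)) (a b : Fin k) : ‖connSeries F_in F_out S x a b‖ ≤ S.card := by
  refine (norm_sum_le _ _).trans ((Finset.sum_le_sum (g := fun _ => (1 : ℝ)) fun z _ => ?_).trans
    (by simp))
  rw [norm_mul, norm_mFourier_apply, mul_one]
  exact norm_connCoeff_le h_in h_out _ _ _

theorem integrable_seriesDeviation (hm_in : Measurable F_in) (hm_out : Measurable F_out)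
    (h_in : ∀ x, F_in x ∈ Set.Icc (0 : ℝ) 1) (h_out : ∀ x, F_out x ∈ Set.Icc (0 : ℝ) 1)
    (σ : Fin n → Fin k) (S : Finset (Fin d → ℤ)) (i j : Fin n) :
    Integrable (fun X => seriesDeviation F_in F_out σ S X i j) (positionMeasure d n) := by
  unfold seriesDeviation
  split_ifs with h
  · exact integrable_zero _ _ _
  refine Integrable.of_bound ((measurable_connProb_sub_connSeries hm_in hm_out S (σ i) (σ j)).comp
    ((measurable_pi_apply i).sub (measurable_pi_apply j) :
        Measurable fun X : Fin n → UnitAddTorus (Fin d) => X i - X j)).aestronglyMeasurable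
    ((1 + S.card : ℝ) ^ 2) (Filter.Eventually.of_forall fun X => ?_)
  rw [norm_pow, norm_norm]
  refine pow_le_pow_left₀ (norm_nonneg _) ((norm_sub_le _ _).trans (add_le_add ?_
    (norm_connSeries_le h_in h_out S _ _ _))) 2
  have := connProb_mem h_in h_out (X i - X j) (σ i) (σ j)
  rw [Complex.norm_real, Real.norm_of_nonneg this.1]
  exact this.2

/-- A single displacement is uniform, so the expectation is the L² truncation error of one of the
two series. -/
theorem integral_seriesDeviation_le (hm_in : Measurable F_in) (hm_out : Measurable F_out)
    (σ : Fin n → Fin k) {S : Finset (Fin d → ℤ)} {ε : ℝ} (hε : 0 ≤ ε)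
    (hS_in : ∫ x, ‖(F_in x : ℂ) - fourierPartialSum F_in S x‖ ^ 2 ∂torusMeasure d ≤ ε)
    (hS_out : ∫ x, ‖(F_out x : ℂ) - fourierPartialSum F_out S x‖ ^ 2 ∂torusMeasure d ≤ ε)
    (i j : Fin n) :
    ∫ X, seriesDeviation F_in F_out σ S X i j ∂positionMeasure d n ≤ ε := by
  unfold seriesDeviation
  split_ifs with h
  · simpa using hε
  rw [integral_displacement h (fun x => ‖(connProb F_in F_out x (σ i) (σ j) : ℂ) -
    connSeries F_in F_out S x (σ i) (σ j)‖ ^ 2)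
    (measurable_connProb_sub_connSeries hm_in hm_out S (σ i) (σ j))]
  unfold connProb connSeries connCoeff
  split_ifs
  · exact hS_in
  · exact hS_out

end PositionStatistics

/-! ### Regular graphs and the failure probability -/

section GoodEvents

variable {d k n : ℕ} {F_in F_out : UnitAddTorus (Fin d) → ℝ}

/-- The squared Frobenius norm of the square of the centred adjacency matrix. -/
def noise (p : Sym2 (Fin n) → ℝ) (G : SimpleGraph (Fin n)) : ℝ :=
  ∑ i, ∑ l, (∑ j, centredEdge p G s(i, j) * centredEdge p G s(j, l)) ^ 2

theorem noise_nonneg (p : Sym2 (Fin n) → ℝ) (G : SimpleGraph (Fin n)) : 0 ≤ noise p G :=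
  Finset.sum_nonneg fun _ _ => Finset.sum_nonneg fun _ _ => sq_nonneg _

/-- The regularity of the graph and of the positions from which exact recovery follows. -/
structure IsRegular (F_in F_out : UnitAddTorus (Fin d) → ℝ) (σ : Fin n → Fin k) (m : ℕ)
    (S : Finset (Fin d → ℤ)) (t₁ t₂ t₃ ε : ℝ) (X : Fin n → UnitAddTorus (Fin d))
    (G : SimpleGraph (Fin n)) : Prop where
  noise_lt : noise (edgeProb F_in F_out σ X) G < t₁
  series_lt : ∑ i, ∑ j, seriesDeviation F_in F_out σ S X i j < t₂
  coeff_lt : ∑ z ∈ S, ∑ l, ∑ j, ‖coeffDeviation F_in F_out σ m X z l j‖ ^ 2 < t₃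
  degree_le : ∀ v l,
    |(labelledNeighbors G σ v l : ℝ) - m * meanProb F_in F_out l (σ v)| ≤ ε * m

/-- A union bound over the ways of failing: Markov for the noise, the series error and the
coefficient errors, Chernoff for the degrees. The law forgets the positions, so a bad graph is
required to be irregular for every X. -/
theorem law_le_of_not_isRegular (hm_in : Measurable F_in) (hm_out : Measurable F_out)
    (h_in : ∀ x, F_in x ∈ Set.Icc (0 : ℝ) 1) (h_out : ∀ x, F_out x ∈ Set.Icc (0 : ℝ) 1)
    (he_in : ∀ x, F_in (-x) = F_in x) (he_out : ∀ x, F_out (-x) = F_out x)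
    {σ : Fin n → Fin k} {m : ℕ} (hσ : Balanced m σ) {S : Finset (Fin d → ℤ)}
    {t₁ t₂ t₃ ε ε' : ℝ} (ht₁ : 0 < t₁) (ht₂ : 0 < t₂) (ht₃ : 0 < t₃) (hε : 0 < ε) (hε1 : ε ≤ 1)
    (hε' : 0 ≤ ε')
    (hS_in : ∫ x, ‖(F_in x : ℂ) - fourierPartialSum F_in S x‖ ^ 2 ∂torusMeasure d ≤ ε')
    (hS_out : ∫ x, ‖(F_out x : ℂ) - fourierPartialSum F_out S x‖ ^ 2 ∂torusMeasure d ≤ ε')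
    (B : Set (SimpleGraph (Fin n)))
    (hB : ∀ G ∈ B, ∀ X, ¬ IsRegular F_in F_out σ m S t₁ t₂ t₃ ε X G) :
    law F_in F_out σ B ≤ ENNReal.ofReal (2 * (n : ℝ) ^ 3 / t₁ + (n : ℝ) ^ 2 * ε' / t₂ +
      S.card * (k * (n * (8 * m + 2))) / t₃ +
      n * (k * (2 * Real.exp (1 - m * (ε ^ 2 / 4))))) := by
  classical
  set R : (Fin n → UnitAddTorus (Fin d)) → ℝ :=
    fun X => ∑ i, ∑ j, seriesDeviation F_in F_out σ S X i j with hR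
  set D : (Fin n → UnitAddTorus (Fin d)) → ℝ :=
    fun X => ∑ z ∈ S, ∑ l, ∑ j, ‖coeffDeviation F_in F_out σ m X z l j‖ ^ 2 with hD
  set H : (Fin n → UnitAddTorus (Fin d)) → ℝ :=
    fun X => ∑ v, ∑ l, (chernoffFactor F_in F_out σ m ε (ε / 2) v l X +
        chernoffFactor F_in F_out σ m ε (-(ε / 2)) v l X) with hH
  have hRint : Integrable R (positionMeasure d n) := integrable_finsetSum _ fun i _ =>
    integrable_finsetSum _ fun j _ => integrable_seriesDeviation hm_in hm_out h_in h_out σ S i j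
  have hDint : Integrable D (positionMeasure d n) := integrable_finsetSum _ fun z _ =>
    integrable_finsetSum _ fun l _ => integrable_finsetSum _ fun j _ =>
      integrable_norm_sq_coeffDeviation hm_in hm_out h_in h_out σ m z l j
  have hcint : ∀ s v l, Integrable (chernoffFactor F_in F_out σ m ε s v l) (positionMeasure d n) :=
    fun s v l => integrable_chernoffFactor hm_in hm_out h_in h_out σ m ε s v l
  have hpint : ∀ v l, Integrable (fun X => chernoffFactor F_in F_out σ m ε (ε / 2) v l X +
      chernoffFactor F_in F_out σ m ε (-(ε / 2)) v l X) (positionMeasure d n) :=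
    fun v l => (hcint _ v l).add (hcint _ v l)
  have hHint : Integrable H (positionMeasure d n) := integrable_finsetSum _ fun v _ =>
    integrable_finsetSum _ fun l _ => hpint v l
  have hRle : ∫ X, R X ∂positionMeasure d n ≤ (n : ℝ) ^ 2 * ε' := by
    rw [hR, integral_finsetSum _ fun i _ => integrable_finsetSum _ fun j _ =>
      integrable_seriesDeviation hm_in hm_out h_in h_out σ S i j]
    calc _ ≤ ∑ i : Fin n, ∑ j : Fin n, ε' := by
          refine Finset.sum_le_sum fun i _ => ?_
          rw [integral_finsetSum _ fun j _ =>
            integrable_seriesDeviation hm_in hm_out h_in h_out σ S i j]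
          exact Finset.sum_le_sum fun j _ =>
            integral_seriesDeviation_le hm_in hm_out σ hε' hS_in hS_out i j
      _ = (n : ℝ) ^ 2 * ε' := by
          simp
          ring
  have hDle : ∫ X, D X ∂positionMeasure d n ≤ S.card * (k * (n * (8 * m + 2))) := by
    rw [hD, integral_finsetSum _ fun z _ => integrable_finsetSum _ fun l _ =>
      integrable_finsetSum _ fun j _ =>
        integrable_norm_sq_coeffDeviation hm_in hm_out h_in h_out σ m z l j]
    calc _ ≤ ∑ z ∈ S, ∑ l : Fin k, ∑ j : Fin n, (8 * m + 2 : ℝ) := by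
          refine Finset.sum_le_sum fun z _ => ?_
          rw [integral_finsetSum _ fun l _ => integrable_finsetSum _ fun j _ =>
            integrable_norm_sq_coeffDeviation hm_in hm_out h_in h_out σ m z l j]
          refine Finset.sum_le_sum fun l _ => ?_
          rw [integral_finsetSum _ fun j _ =>
            integrable_norm_sq_coeffDeviation hm_in hm_out h_in h_out σ m z l j]
          exact Finset.sum_le_sum fun j _ =>
            integral_norm_sq_coeffDeviation_le hm_in hm_out h_in h_out hσ z l j
      _ = _ := by
          simp
          ring
  have hHle : ∫ X, H X ∂positionMeasure d n ≤
      n * (k * (2 * Real.exp (1 - m * (ε ^ 2 / 4)))) := by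
    rw [hH, integral_finsetSum _ fun v _ => integrable_finsetSum _ fun l _ =>
      hpint v l]
    calc _ ≤ ∑ v : Fin n, ∑ l : Fin k, 2 * Real.exp (1 - m * (ε ^ 2 / 4)) := by
          refine Finset.sum_le_sum fun v _ => ?_
          rw [integral_finsetSum _ fun l _ => hpint v l]
          refine Finset.sum_le_sum fun l _ => ?_
          rw [integral_add (hcint _ v l) (hcint _ v l), two_mul]
          refine add_le_add ?_ ?_
          · exact integral_chernoffFactor_le hm_in hm_out h_in h_out hσ hε1
              (abs_of_pos (half_pos hε)) v l
          · exact integral_chernoffFactor_le hm_in hm_out h_in h_out hσ hε1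
              (by rw [abs_neg, abs_of_pos (half_pos hε)]) v l
      _ = _ := by simp
  have hΦ : Integrable (fun X => 2 * (n : ℝ) ^ 3 / t₁ + R X / t₂ + D X / t₃ + H X)
      (positionMeasure d n) :=
    (((integrable_const _).add (hRint.div_const _)).add (hDint.div_const _)).add hHint
  refine (law_le_of_condProb_le hm_in hm_out h_in h_out σ B _ hΦ fun X => ?_).trans
    (ENNReal.ofReal_le_ofReal ?_)
  · have hp := edgeProb_mem h_in h_out σ X
    have hw : ∀ G, condProb F_in F_out σ X G = graphWeight (edgeProb F_in F_out σ X) G :=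
      fun G => condProb_eq_graphWeight (edgeProb_mk he_in he_out σ X) G
    simp only [hw]
    have hw0 := graphWeight_nonneg hp
    have hdeg := sum_graphWeight_degree_deviation_le h_in h_out he_in he_out σ m hε X
    have hnoise : ∑ G with t₁ ≤ noise (edgeProb F_in F_out σ X) G,
        graphWeight (edgeProb F_in F_out σ X) G ≤ 2 * (n : ℝ) ^ 3 / t₁ := by
      refine (sum_graphWeight_filter_le hp _ (fun G => noise (edgeProb F_in F_out σ X) G / t₁)
        (fun G => div_nonneg (noise_nonneg _ _) ht₁.le)
        (fun G hG => (one_le_div ht₁).2 hG)).trans ?_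
      simp only [← mul_div_assoc]
      rw [← Finset.sum_div]
      exact div_le_div_of_nonneg_right (sum_graphWeight_mul_noise_le hp) ht₁.le
    have hR0 : 0 ≤ R X := Finset.sum_nonneg fun i _ => Finset.sum_nonneg fun j _ => by
      unfold seriesDeviation
      split_ifs <;> positivity
    have hD0 : 0 ≤ D X := Finset.sum_nonneg fun z _ => Finset.sum_nonneg fun l _ =>
      Finset.sum_nonneg fun j _ => by positivity
    have hH0 : 0 ≤ H X := le_trans (Finset.sum_nonneg fun G _ => hw0 G) hdeg
    have hN0 : 0 ≤ 2 * (n : ℝ) ^ 3 / t₁ := by positivity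
    have hR0' : 0 ≤ R X / t₂ := by positivity
    have hD0' : 0 ≤ D X / t₃ := by positivity
    have htot : ∑ G with G ∈ B, graphWeight (edgeProb F_in F_out σ X) G ≤ 1 := by
      rw [← sum_graphWeight (edgeProb F_in F_out σ X)]
      exact Finset.sum_le_sum_of_subset_of_nonneg (Finset.filter_subset _ _) fun G _ _ => hw0 G
    -- For bad positions the bound already exceeds 1; for good ones irregularity can only come from
    -- the noise or the degrees.
    by_cases h2 : t₂ ≤ R X
    · have : 1 ≤ R X / t₂ := (one_le_div ht₂).2 h2
      linarith
    by_cases h3 : t₃ ≤ D X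
    · have : 1 ≤ D X / t₃ := (one_le_div ht₃).2 h3
      linarith
    have hsub : (Finset.univ.filter fun G => G ∈ B) ⊆
        (Finset.univ.filter fun G => t₁ ≤ noise (edgeProb F_in F_out σ X) G) ∪
        (Finset.univ.filter fun G => ∃ v l,
          ε * m < |(labelledNeighbors G σ v l : ℝ) - m * meanProb F_in F_out l (σ v)|) := by
      intro G hG
      have hG' := hB G (Finset.mem_filter.1 hG).2 X
      simp only [Finset.mem_union, Finset.mem_filter, Finset.mem_univ, true_and]
      by_contra hcon
      push Not at hcon
      exact hG' ⟨hcon.1, not_le.1 h2, not_le.1 h3, hcon.2⟩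
    have h4 := Finset.sum_le_sum_of_subset_of_nonneg hsub fun G _ _ => hw0 G
    have h5 := Finset.sum_union_inter (f := graphWeight (edgeProb F_in F_out σ X))
      (s₁ := Finset.univ.filter fun G => t₁ ≤ noise (edgeProb F_in F_out σ X) G)
      (s₂ := Finset.univ.filter fun G => ∃ v l,
          ε * m < |(labelledNeighbors G σ v l : ℝ) - m * meanProb F_in F_out l (σ v)|)
    have h6 : 0 ≤ ∑ G ∈ (Finset.univ.filter fun G => t₁ ≤ noise (edgeProb F_in F_out σ X) G) ∩
        (Finset.univ.filter fun G => ∃ v l,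
          ε * m < |(labelledNeighbors G σ v l : ℝ) - m * meanProb F_in F_out l (σ v)|),
        graphWeight (edgeProb F_in F_out σ X) G := Finset.sum_nonneg fun G _ => hw0 G
    linarith
  · have hi₁ : Integrable (fun X => 2 * (n : ℝ) ^ 3 / t₁ + R X / t₂) (positionMeasure d n) :=
      (integrable_const _).add (hRint.div_const _)
    have hi₂ : Integrable (fun X => 2 * (n : ℝ) ^ 3 / t₁ + R X / t₂ + D X / t₃)
        (positionMeasure d n) := hi₁.add (hDint.div_const _)
    rw [integral_add hi₂ hHint, integral_add hi₁ (hDint.div_const _),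
      integral_add (integrable_const _) (hRint.div_const _), integral_div t₂, integral_div t₃]
    have h2 := div_le_div_of_nonneg_right hRle ht₂.le
    have h3 := div_le_div_of_nonneg_right hDle ht₃.le
    simp only [integral_const, probReal_univ, smul_eq_mul, one_mul]
    linarith

end GoodEvents

/-! ### k-means and local improvement -/

section Clustering

variable {d k n r m : ℕ}

theorem kmeansCost_eq (V : Matrix (Fin n) (Fin r) ℝ) (τ : Fin n → Fin k)
    (Y : Matrix (Fin k) (Fin r) ℝ) :
    kmeansCost V τ Y = ∑ i, ∑ j, (Y (τ i) j - V i j) ^ 2 := by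
  simp [kmeansCost, membership, Matrix.mul_apply]

/-- If the rows of `V` are close to well separated centres, one for each community, then
approximate `k`-means recovers most labels up to a permutation. -/
theorem exists_perm_of_isApproxKMeans {σ τ : Fin n → Fin k} (hσ : Balanced m σ)
    (hm : 0 < m) {V : Matrix (Fin n) (Fin r) ℝ} (Y : Matrix (Fin k) (Fin r) ℝ) {κ η : ℝ}
    (hη : 0 ≤ η) (hκ : ∑ i, ∑ j, (Y (σ i) j - V i j) ^ 2 ≤ κ)
    (hsep : ∀ a b, a ≠ b → 1 / (m : ℝ) ≤ ∑ j, (Y a j - Y b j) ^ 2)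
    (hτ : IsApproxKMeans η V τ) (hsmall : 8 * (2 + η) * κ < 1) :
    ∃ π : Equiv.Perm (Fin k),
      ((Finset.univ.filter fun i => τ i ≠ π (σ i)).card : ℝ) ≤ 8 * (2 + η) * κ * m := by
  have hm' : (0 : ℝ) < m := Nat.cast_pos.2 hm
  obtain ⟨Z, hZ⟩ := hτ
  have h1 := hZ σ Y
  rw [kmeansCost_eq, kmeansCost_eq] at h1
  -- Squared distance from the centroid assigned to i by the k-means solution to the true centre of
  -- i. The sum is at most 2(1 + η)κ + 2κ.
  set e : Fin n → ℝ := fun i => ∑ j, (Z (τ i) j - Y (σ i) j) ^ 2 with he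
  have he0 : ∀ i, 0 ≤ e i := fun i => Finset.sum_nonneg fun j _ => sq_nonneg _
  have h2 : ∑ i, e i ≤ 2 * (2 + η) * κ := by
    have h3 : ∑ i, e i ≤
        2 * ∑ i, ∑ j, (Z (τ i) j - V i j) ^ 2 + 2 * ∑ i, ∑ j, (Y (σ i) j - V i j) ^ 2 := by
      simp only [he, Finset.mul_sum, ← Finset.sum_add_distrib]
      refine Finset.sum_le_sum fun i _ => Finset.sum_le_sum fun j _ => ?_
      nlinarith [sq_nonneg ((Z (τ i) j - V i j) + (Y (σ i) j - V i j))]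
    have h4 := mul_le_mul_of_nonneg_left hκ (by linarith : (0 : ℝ) ≤ 1 + η)
    linarith
  -- The threshold 1/(4m) corresponds to half the distance between centres, so two good vertices
  -- sharing a k-means label lie in the same community.
  set bad := Finset.univ.filter fun i => 1 / (4 * (m : ℝ)) ≤ e i with hbad
  have hcard : (bad.card : ℝ) ≤ 8 * (2 + η) * κ * m := by
    have h5 : (bad.card : ℝ) * (1 / (4 * (m : ℝ))) ≤ ∑ i, e i := by
      calc (bad.card : ℝ) * (1 / (4 * (m : ℝ))) ≤ ∑ i ∈ bad, e i := by
            rw [← nsmul_eq_mul]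
            exact Finset.card_nsmul_le_sum _ _ _ fun i hi => (Finset.mem_filter.1 hi).2
        _ ≤ ∑ i, e i := Finset.sum_le_sum_of_subset_of_nonneg (Finset.subset_univ _)
            fun i _ _ => he0 i
    have h6 := h5.trans h2
    rw [mul_one_div, div_le_iff₀ (by positivity)] at h6
    linarith
  have hbadm : bad.card < m := by
    have : (bad.card : ℝ) < m := hcard.trans_lt (by nlinarith)
    exact_mod_cast this
  -- There are fewer than m bad vertices, so every community has a good one; the labels of these
  -- representatives are distinct and define the permutation.
  have hgood : ∀ l, ∃ i, σ i = l ∧ i ∉ bad := by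
    intro l
    by_contra hcon
    push Not at hcon
    have : (Finset.univ.filter fun i => σ i = l) ⊆ bad := fun i hi =>
      hcon i (Finset.mem_filter.1 hi).2
    have := Finset.card_le_card this
    rw [hσ l] at this
    omega
  have hinj : ∀ i i', i ∉ bad → i' ∉ bad → τ i = τ i' → σ i = σ i' := by
    intro i i' hi hi' hii
    by_contra hne
    have h7 := hsep _ _ hne
    simp only [hbad, Finset.mem_filter, Finset.mem_univ, true_and, not_le] at hi hi'
    have h8 : ∑ j, (Y (σ i) j - Y (σ i') j) ^ 2 ≤ 2 * e i + 2 * e i' := by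
      simp only [he, Finset.mul_sum, ← Finset.sum_add_distrib, hii]
      refine Finset.sum_le_sum fun j _ => ?_
      nlinarith [sq_nonneg ((Z (τ i') j - Y (σ i) j) + (Z (τ i') j - Y (σ i') j))]
    have h9 : 1 / (m : ℝ) = 4 * (1 / (4 * (m : ℝ))) := by field_simp
    linarith
  choose ρ hρ hρ' using hgood
  have hπ : Function.Injective fun l => τ (ρ l) := by
    intro a b hab
    have := hinj _ _ (hρ' a) (hρ' b) hab
    rwa [hρ, hρ] at this
  refine ⟨Equiv.ofBijective _ (Finite.injective_iff_bijective.1 hπ), le_trans ?_ hcard⟩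
  refine Nat.cast_le.2 (Finset.card_le_card fun i hi => ?_)
  have hi' := (Finset.mem_filter.1 hi).2
  by_contra hib
  obtain ⟨l, hl⟩ := (Finite.injective_iff_bijective.1 hπ).2 (τ i)
  have h10 := hinj _ _ (hρ' l) hib hl
  rw [hρ] at h10
  exact hi' (by simp [← hl, h10])

/-- When the degrees concentrate, one round of local improvement corrects all errors of a labelling
that has few of them. -/
theorem loss_eq_zero_of_isLocalImprovement {F_in F_out : UnitAddTorus (Fin d) → ℝ}
    {G : SimpleGraph (Fin n)} {σ τ τ' : Fin n → Fin k} (hm : 0 < m) {ε β : ℝ}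
    (hdeg : ∀ v l,
      |(labelledNeighbors G σ v l : ℝ) - m * meanProb F_in F_out l (σ v)| ≤ ε * m)
    (π : Equiv.Perm (Fin k))
    (hπ : ((Finset.univ.filter fun i => τ i ≠ π (σ i)).card : ℝ) ≤ β * m)
    (hεβ : 2 * ε + 2 * β < density F_in - density F_out) (hτ : IsLocalImprovement G τ τ') :
    loss σ τ' = 0 := by
  classical
  have hm' : (0 : ℝ) < m := Nat.cast_pos.2 hm
  set bad := Finset.univ.filter fun i => τ i ≠ π (σ i) with hbad
  have hge : ∀ v l, labelledNeighbors G σ v l ≤ labelledNeighbors G τ v (π l) + bad.card := by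
    intro v l
    unfold labelledNeighbors
    refine (Finset.card_le_card fun j hj => ?_).trans (Finset.card_union_le _ _)
    simp only [hbad, Finset.mem_union, Finset.mem_filter, Finset.mem_univ, true_and] at hj ⊢
    by_cases h : τ j = π (σ j)
    · exact Or.inl ⟨hj.1, by rw [h, hj.2]⟩
    · exact Or.inr h
  have hle : ∀ v l, labelledNeighbors G τ v (π l) ≤ labelledNeighbors G σ v l + bad.card := by
    intro v l
    unfold labelledNeighbors
    refine (Finset.card_le_card fun j hj => ?_).trans (Finset.card_union_le _ _)
    simp only [hbad, Finset.mem_union, Finset.mem_filter, Finset.mem_univ, true_and] at hj ⊢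
    by_cases h : τ j = π (σ j)
    · exact Or.inl ⟨hj.1, π.injective (by rw [← h, hj.2])⟩
    · exact Or.inr h
  have hmain : ∀ v, τ' v = π (σ v) := by
    intro v
    by_contra hne
    obtain ⟨l, hl⟩ := π.surjective (τ' v)
    have hlσ : l ≠ σ v := fun h => hne (by rw [← hl, h])
    have h1 := hτ v (π (σ v))
    rw [← hl] at h1
    have h2 := (hge v (σ v)).trans (Nat.add_le_add_right (h1.trans (hle v l)) _)
    have h3 : (labelledNeighbors G σ v (σ v) : ℝ) ≤
        labelledNeighbors G σ v l + bad.card + bad.card := by exact_mod_cast h2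
    have h4 := abs_le.1 (hdeg v (σ v))
    have h5 := abs_le.1 (hdeg v l)
    simp only [meanProb, if_true, if_neg hlσ] at h4 h5
    -- A wrong vote would need Δm ≤ 2εm + 2|bad|: one degree error and one labelling error on each
    -- side. This contradicts `hεβ`.
    nlinarith [h4.1, h5.2]
  have hzero : absError σ τ' = 0 := by
    unfold absError
    refine Nat.sInf_eq_zero.2 (Or.inl ⟨σ, ?_, ?_⟩)
    · intro i j
      simp [hmain]
    · simp
  simp [loss, hzero]

end Clustering

/-! ### Perturbation of the eigenspace nearest to the target eigenvalue -/

section Spectral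

variable {k n m : ℕ}

theorem sum_mul_eq_sum_community {R : Type*} [CommSemiring R] (σ : Fin n → Fin k) (f : Fin k → R)
    (g : Fin n → R) : ∑ i, f (σ i) * g i = ∑ l, f l * ∑ i ∈ community σ l, g i := by
  classical
  rw [← Finset.sum_fiberwise Finset.univ σ]
  refine Finset.sum_congr rfl fun l _ => ?_
  rw [Finset.mul_sum]
  refine Finset.sum_congr rfl fun i hi => ?_
  rw [(Finset.mem_filter.1 hi).2]

/-- The vector that is constant on communities, with values `x`. -/
def blockVector (σ : Fin n → Fin k) : (Fin k → ℝ) →ₗ[ℝ] EuclideanSpace ℝ (Fin n) where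
  toFun x := WithLp.toLp 2 fun i => x (σ i)
  map_add' _ _ := rfl
  map_smul' _ _ := rfl

theorem blockVector_apply (σ : Fin n → Fin k) (x : Fin k → ℝ) (i : Fin n) :
    blockVector σ x i = x (σ i) := rfl

theorem inner_blockVector (σ : Fin n → Fin k) (x : Fin k → ℝ) (w : EuclideanSpace ℝ (Fin n)) :
    inner ℝ (blockVector σ x) w = ∑ l, x l * ∑ i ∈ community σ l, w i := by
  rw [← sum_mul_eq_sum_community, PiLp.inner_apply]
  refine Finset.sum_congr rfl fun i _ => ?_
  rw [blockVector_apply]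
  simp [mul_comm]

theorem norm_sq_blockVector {σ : Fin n → Fin k} (hσ : Balanced m σ) (x : Fin k → ℝ) :
    ‖blockVector σ x‖ ^ 2 = m * ∑ l, x l ^ 2 := by
  rw [← real_inner_self_eq_norm_sq, inner_blockVector, Finset.mul_sum]
  refine Finset.sum_congr rfl fun l _ => ?_
  have : ∀ i ∈ community σ l, blockVector σ x i = x l := fun i hi => by
    rw [blockVector_apply, mem_community.1 hi]
  rw [Finset.sum_congr rfl this, Finset.sum_const, show (community σ l).card = m from hσ l,
    nsmul_eq_mul]
  ring

section Eigenbasis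

variable {T : EuclideanSpace ℝ (Fin n) →ₗ[ℝ] EuclideanSpace ℝ (Fin n)}
  {b : OrthonormalBasis (Fin n) ℝ (EuclideanSpace ℝ (Fin n))} {ev : Fin n → ℝ}

/-- The orthonormal eigenbasis diagonalises T − c, so ‖Tw − cw‖² can be compared coordinatewise with
‖w‖² in the estimates below. -/
theorem inner_eigenbasis_sub (hb : ∀ i, T (b i) = ev i • b i) (c : ℝ) (i : Fin n)
    (w : EuclideanSpace ℝ (Fin n)) :
    inner ℝ (b i) (T w - c • w) = (ev i - c) * inner ℝ (b i) w := by
  have h : T w = ∑ j, inner ℝ (b j) w • ev j • b j := by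
    conv_lhs => rw [← b.sum_repr' w]
    simp [map_sum, hb]
  have h2 : inner ℝ (b i) (T w) = ev i * inner ℝ (b i) w := by
    rw [h, inner_sum, Finset.sum_eq_single i]
    · simp [inner_smul_right, mul_comm]
    · intro j _ hj
      simp [inner_smul_right, b.orthonormal.inner_eq_zero hj.symm]
    · simp
  rw [inner_sub_right, h2, inner_smul_right]
  ring

theorem norm_sq_sub_smul_eq (hb : ∀ i, T (b i) = ev i • b i) (c : ℝ)
    (w : EuclideanSpace ℝ (Fin n)) :
    ‖T w - c • w‖ ^ 2 = ∑ i, (ev i - c) ^ 2 * inner ℝ (b i) w ^ 2 := by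
  rw [← b.sum_sq_norm_inner_right]
  refine Finset.sum_congr rfl fun i _ => ?_
  rw [inner_eigenbasis_sub hb, Real.norm_eq_abs, sq_abs, mul_pow]

theorem norm_sq_eq_sum_inner (w : EuclideanSpace ℝ (Fin n)) :
    ‖w‖ ^ 2 = ∑ i, inner ℝ (b i) w ^ 2 := by
  rw [← b.sum_sq_norm_inner_right]
  simp

theorem exists_inner_ne_zero {w : EuclideanSpace ℝ (Fin n)} (hw : w ≠ 0) :
    ∃ i, inner ℝ (b i) w ≠ 0 := by
  by_contra hcon
  push Not at hcon
  have := norm_sq_eq_sum_inner (b := b) w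
  simp only [hcon] at this
  simp at this
  exact hw this

variable {σ : Fin n → Fin k} {c ε δ : ℝ}

/-- Approximate eigenvectors on the block vectors force the closest eigenvalues to be near. -/
theorem abs_closest_eigenvalue_sub_le (hσ : Balanced m σ) (hm : 0 < m)
    (hb : ∀ i, T (b i) = ev i • b i) (e : Fin (k - 1) ↪ Fin n)
    (he : ∀ i, i ∉ Set.range e → ∀ j, |ev (e j) - c| ≤ |ev i - c|) (hε : 0 ≤ ε)
    (hU : ∀ x : Fin k → ℝ, ∑ l, x l = 0 →
      ‖T (blockVector σ x) - c • blockVector σ x‖ ≤ ε * ‖blockVector σ x‖) (j : Fin (k - 1)) :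
    |ev (e j) - c| ≤ ε := by
  classical
  by_contra hj
  push Not at hj
  set J : Finset (Fin n) := Finset.univ.filter fun i => |ev i - c| ≤ ε with hJ
  -- If a selected eigenvalue is farther than ε, all those within ε must be among the other k − 2
  -- selected ones.
  have hsub : J ⊆ (Finset.univ.image e).erase (e j) := by
    intro i hi
    have hi' := (Finset.mem_filter.1 hi).2
    refine Finset.mem_erase.2 ⟨fun h => ?_, ?_⟩
    · rw [h] at hi'
      linarith
    · by_contra hr
      have : i ∉ Set.range e := fun ⟨q, hq⟩ => hr (Finset.mem_image.2 ⟨q, Finset.mem_univ q, hq⟩)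
      linarith [he i this j]
  have hcard : J.card + 1 < k := by
    have h1 := Finset.card_le_card hsub
    rw [Finset.card_erase_of_mem (Finset.mem_image_of_mem e (Finset.mem_univ j)),
      Finset.card_image_of_injective _ e.injective, Finset.card_univ, Fintype.card_fin] at h1
    have := j.isLt
    omega
  -- At most k − 1 linear conditions on k unknowns: some nonzero centred block vector is orthogonal
  -- to all eigenvectors in `J`, and T − c expands it by more than ε.
  let L : (Fin k → ℝ) →ₗ[ℝ] (J → ℝ) × ℝ :=
    (LinearMap.pi fun i : J => (innerₛₗ ℝ (b i)).comp (blockVector σ)).prod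
      (∑ l, LinearMap.proj l)
  have hker : LinearMap.ker L ≠ ⊥ := by
    refine LinearMap.ker_ne_bot_of_finrank_lt ?_
    simpa using hcard
  obtain ⟨x, hx, hx0⟩ := Submodule.exists_mem_ne_zero_of_ne_bot hker
  rw [LinearMap.mem_ker, Prod.ext_iff] at hx
  have hx1 : ∀ i ∈ J, inner ℝ (b i) (blockVector σ x) = 0 := fun i hi =>
    congrFun hx.1 ⟨i, hi⟩
  have hx2 : ∑ l, x l = 0 := by
    have := hx.2
    simpa [L, LinearMap.sum_apply] using this
  set u := blockVector σ x with hu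
  have hu0 : u ≠ 0 := by
    intro h
    have h1 := norm_sq_blockVector hσ x
    rw [← hu, h, norm_zero] at h1
    have h2 : ∑ l, x l ^ 2 = 0 := by
      have : (m : ℝ) ≠ 0 := Nat.cast_ne_zero.2 hm.ne'
      simpa [this, eq_comm] using h1
    rw [Finset.sum_eq_zero_iff_of_nonneg fun l _ => sq_nonneg _] at h2
    exact hx0 (funext fun l => by simpa using h2 l (Finset.mem_univ l))
  have hlt : ε ^ 2 * ‖u‖ ^ 2 < ‖T u - c • u‖ ^ 2 := by
    rw [norm_sq_sub_smul_eq hb, norm_sq_eq_sum_inner (b := b) u, Finset.mul_sum]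
    have hstrict : ∀ i, i ∉ J → ε ^ 2 < (ev i - c) ^ 2 := by
      intro i hi
      have : ε < |ev i - c| := by simpa [hJ] using hi
      rw [← sq_abs (ev i - c)]
      exact pow_lt_pow_left₀ this hε two_ne_zero
    obtain ⟨i, hi⟩ := exists_inner_ne_zero (b := b) hu0
    refine Finset.sum_lt_sum (fun i _ => ?_) ⟨i, Finset.mem_univ i, ?_⟩
    · by_cases hiJ : i ∈ J
      · simp [hx1 i hiJ]
      · exact mul_le_mul_of_nonneg_right (hstrict i hiJ).le (sq_nonneg _)
    · exact mul_lt_mul_of_pos_right (hstrict i fun h => hi (hx1 i h)) (by positivity)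
  have := pow_le_pow_left₀ (norm_nonneg _) (hU x hx2) 2
  rw [mul_pow] at this
  linarith

/-- If `T - c` is bounded below on vectors orthogonal to the centred block vectors, then only
`k - 1` eigenvalues are close to `c`. -/
theorem le_abs_eigenvalue_sub (hk : 2 ≤ k) (hb : ∀ i, T (b i) = ev i • b i)
    (e : Fin (k - 1) ↪ Fin n) (hclose : ∀ j, |ev (e j) - c| < δ) (hδ : 0 ≤ δ)
    (hW : ∀ w : EuclideanSpace ℝ (Fin n),
      (∀ l l', ∑ i ∈ community σ l, w i = ∑ i ∈ community σ l', w i) →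
        δ * ‖w‖ ≤ ‖T w - c • w‖) (i₀ : Fin n) (hi₀ : i₀ ∉ Set.range e) :
    δ ≤ |ev i₀ - c| := by
  classical
  by_contra hlt
  push Not at hlt
  set I : Finset (Fin n) := insert i₀ (Finset.univ.image e) with hI
  have hIcard : I.card = k := by
    rw [hI, Finset.card_insert_of_notMem, Finset.card_image_of_injective _ e.injective,
      Finset.card_univ, Fintype.card_fin]
    · omega
    · simpa using hi₀
  have hIlt : ∀ i ∈ I, |ev i - c| < δ := by
    intro i hi
    rcases Finset.mem_insert.1 hi with rfl | hi
    · exact hlt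
    · obtain ⟨j, _, rfl⟩ := Finset.mem_image.1 hi
      exact hclose j
  let q₀ : Fin k := ⟨0, by omega⟩
  let S : Fin k → EuclideanSpace ℝ (Fin n) →ₗ[ℝ] ℝ := fun l =>
    ∑ i ∈ community σ l, (EuclideanSpace.proj i : EuclideanSpace ℝ (Fin n) →L[ℝ] ℝ).toLinearMap
  have hS : ∀ l w, S l w = ∑ i ∈ community σ l, w i := by
    intro l w
    simp [S, LinearMap.sum_apply]
  -- Lying in the span of the k eigenvectors in `I` is n − k conditions and having equal community
  -- sums is k − 1 more, so a nonzero w satisfies all n − 1 of them.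
  let L : EuclideanSpace ℝ (Fin n) →ₗ[ℝ]
      ({i // i ∈ Iᶜ} → ℝ) × ({q // q ∈ ({q₀} : Finset (Fin k))ᶜ} → ℝ) :=
    (LinearMap.pi fun i => innerₛₗ ℝ (b i.1)).prod (LinearMap.pi fun q => S q.1 - S q₀)
  have hker : LinearMap.ker L ≠ ⊥ := by
    refine LinearMap.ker_ne_bot_of_finrank_lt ?_
    have h1 : I.card ≤ n := by simpa using Finset.card_le_univ I
    rw [Module.finrank_prod, Module.finrank_fintype_fun_eq_card, Module.finrank_fintype_fun_eq_card,
      finrank_euclideanSpace, Fintype.card_coe, Fintype.card_coe, Finset.card_compl,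
      Finset.card_compl, Finset.card_singleton, Fintype.card_fin, Fintype.card_fin, hIcard]
    omega
  obtain ⟨w, hw, hw0⟩ := Submodule.exists_mem_ne_zero_of_ne_bot hker
  rw [LinearMap.mem_ker, Prod.ext_iff] at hw
  have hw1 : ∀ i ∉ I, inner ℝ (b i) w = 0 := fun i hi =>
    congrFun hw.1 ⟨i, Finset.mem_compl.2 hi⟩
  have hw2 : ∀ q, S q w = S q₀ w := by
    intro q
    by_cases hq : q = q₀
    · rw [hq]
    · exact sub_eq_zero.1 (congrFun hw.2 ⟨q, by simpa using hq⟩)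
  have h1 := hW w fun l l' => by rw [← hS, ← hS, hw2 l, hw2 l']
  have h2 : ‖T w - c • w‖ ^ 2 < δ ^ 2 * ‖w‖ ^ 2 := by
    rw [norm_sq_sub_smul_eq hb, norm_sq_eq_sum_inner (b := b) w, Finset.mul_sum]
    have hstrict : ∀ i, i ∈ I → (ev i - c) ^ 2 < δ ^ 2 := by
      intro i hi
      rw [← sq_abs (ev i - c)]
      exact pow_lt_pow_left₀ (hIlt i hi) (abs_nonneg _) two_ne_zero
    obtain ⟨i, hi⟩ := exists_inner_ne_zero (b := b) hw0
    refine Finset.sum_lt_sum (fun i _ => ?_) ⟨i, Finset.mem_univ i, ?_⟩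
    · by_cases hiI : i ∈ I
      · exact mul_le_mul_of_nonneg_right (hstrict i hiI).le (sq_nonneg _)
      · simp [hw1 i hiI]
    · refine mul_lt_mul_of_pos_right (hstrict i ?_) (by positivity)
      by_contra h
      exact hi (hw1 i h)
  have h3 := pow_le_pow_left₀ (mul_nonneg hδ (norm_nonneg _)) h1 2
  rw [mul_pow] at h3
  linarith

/-- The mean of the entries of `v` in community `l`, minus the mean over all communities. -/
def centredMean (σ : Fin n → Fin k) (m : ℕ) (v : EuclideanSpace ℝ (Fin n)) (l : Fin k) : ℝ :=
  (∑ i ∈ community σ l, v i) / m - (∑ q, (∑ i ∈ community σ q, v i) / m) / k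

theorem sum_centredMean (hk : 0 < k) (v : EuclideanSpace ℝ (Fin n)) :
    ∑ l, centredMean σ m v l = 0 := by
  have : (k : ℝ) ≠ 0 := Nat.cast_ne_zero.2 hk.ne'
  simp only [centredMean, Finset.sum_sub_distrib, Finset.sum_const, Finset.card_univ,
    Fintype.card_fin, nsmul_eq_mul]
  field_simp
  ring

/-- The block vector u of centred means is the orthogonal projection of v onto the centred block
vectors. So v − u satisfies the lower bound `hW`, while T − c maps both v and u to vectors of norm
at most ε. -/
theorem norm_sub_blockVector_centredMean_le (hσ : Balanced m σ) (hm : 0 < m) (hk : 0 < k)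
    (hε : 0 ≤ ε) (hδ : 0 < δ)
    (hU : ∀ x : Fin k → ℝ, ∑ l, x l = 0 →
      ‖T (blockVector σ x) - c • blockVector σ x‖ ≤ ε * ‖blockVector σ x‖)
    (hW : ∀ w : EuclideanSpace ℝ (Fin n),
      (∀ l l', ∑ i ∈ community σ l, w i = ∑ i ∈ community σ l', w i) →
        δ * ‖w‖ ≤ ‖T w - c • w‖)
    {v : EuclideanSpace ℝ (Fin n)} (hv : ‖v‖ = 1) (hTv : ‖T v - c • v‖ ≤ ε) :
    ‖v - blockVector σ (centredMean σ m v)‖ ≤ 2 * ε / δ := by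
  have hm' : (m : ℝ) ≠ 0 := Nat.cast_ne_zero.2 hm.ne'
  set x := centredMean σ m v with hx
  set s : ℝ := (∑ q, (∑ i ∈ community σ q, v i) / m) / k with hs
  have hsum : ∀ l, ∑ i ∈ community σ l, v i = m * (x l + s) := by
    intro l
    rw [hx, centredMean, ← hs]
    field_simp
    ring
  have hx0 : ∑ l, x l = 0 := sum_centredMean hk v
  set u := blockVector σ x with hu
  have hu1 : ‖u‖ ≤ 1 := by
    have h1 : inner ℝ u v = ‖u‖ ^ 2 := by
      rw [hu, inner_blockVector, norm_sq_blockVector hσ]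
      simp only [hsum]
      have : ∀ l, x l * (m * (x l + s)) = m * x l ^ 2 + (m * s) * x l := fun l => by ring
      simp only [this]
      rw [Finset.sum_add_distrib, ← Finset.mul_sum, ← Finset.mul_sum, hx0]
      ring
    have h2 := real_inner_le_norm u v
    rw [h1, hv, mul_one] at h2
    nlinarith [norm_nonneg u]
  have hwsum : ∀ l, ∑ i ∈ community σ l, (v - u) i = m * s := by
    intro l
    have h1 : ∀ i ∈ community σ l, (v - u) i = v i - x l := fun i hi => by
      rw [PiLp.sub_apply, hu, blockVector_apply, mem_community.1 hi]
    rw [Finset.sum_congr rfl h1, Finset.sum_sub_distrib, hsum, Finset.sum_const,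
      show (community σ l).card = m from hσ l, nsmul_eq_mul]
    ring
  have h3 := hW (v - u) fun l l' => by rw [hwsum, hwsum]
  have h4 : T (v - u) - c • (v - u) = (T v - c • v) - (T u - c • u) := by
    rw [map_sub, smul_sub]
    abel
  have h5 := norm_sub_le (T v - c • v) (T u - c • u)
  have h6 := hU x hx0
  rw [← h4] at h5
  rw [le_div_iff₀ hδ]
  nlinarith

end Eigenbasis

/-- The embedding by the eigenvectors for the closest eigenvalues maps the communities near well
separated centres. -/
theorem exists_centres_of_isClosestEigenvectors (hk : 2 ≤ k) {σ : Fin n → Fin k}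
    (hσ : Balanced m σ) (hm : 0 < m) {A : Matrix (Fin n) (Fin n) ℝ} {c ε δ : ℝ}
    {V : Matrix (Fin n) (Fin (k - 1)) ℝ} (hV : IsClosestEigenvectors A c V)
    (hε : 0 ≤ ε) (hδ : 0 < δ) (hεδ : 2 * ε ^ 2 ≤ δ ^ 2)
    (hU : ∀ x : Fin k → ℝ, ∑ l, x l = 0 →
      ‖Matrix.toEuclideanLin A (blockVector σ x) - c • blockVector σ x‖ ≤
        ε * ‖blockVector σ x‖)
    (hW : ∀ w : EuclideanSpace ℝ (Fin n),
      (∀ l l', ∑ i ∈ community σ l, w i = ∑ i ∈ community σ l', w i) →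
        δ * ‖w‖ ≤ ‖Matrix.toEuclideanLin A w - c • w‖) :
    ∃ Y : Matrix (Fin k) (Fin (k - 1)) ℝ,
      ∑ i, ∑ j, (Y (σ i) j - V i j) ^ 2 ≤ k * (2 * ε / δ) ^ 2 ∧
      ∀ a b, a ≠ b → 1 / (m : ℝ) ≤ ∑ j, (Y a j - Y b j) ^ 2 := by
  classical
  obtain ⟨b, ev, e, hb, -, he, hVb⟩ := hV
  have hm' : (0 : ℝ) < m := Nat.cast_pos.2 hm
  have hεδ' : ε < δ := by nlinarith
  have hclose := abs_closest_eigenvalue_sub_le hσ hm hb e he hε hU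
  have hfar := le_abs_eigenvalue_sub hk hb e (fun j => (hclose j).trans_lt hεδ') hδ.le hW
  refine ⟨fun l j => centredMean σ m (b (e j)) l, ?_, ?_⟩
  · rw [Finset.sum_comm]
    have h1 : ∀ j : Fin (k - 1), ∑ i, (centredMean σ m (b (e j)) (σ i) - V i j) ^ 2 ≤
        (2 * ε / δ) ^ 2 := by
      intro j
      have h2 := norm_sub_blockVector_centredMean_le hσ hm (by omega) hε hδ hU hW
        (b.norm_eq_one (e j)) (v := b (e j)) (by
          rw [hb, ← sub_smul, norm_smul, b.norm_eq_one, mul_one]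
          exact hclose j)
      have h3 := pow_le_pow_left₀ (norm_nonneg _) h2 2
      rw [EuclideanSpace.norm_sq_eq] at h3
      refine le_trans (le_of_eq (Finset.sum_congr rfl fun i _ => ?_)) h3
      rw [Real.norm_eq_abs, sq_abs, PiLp.sub_apply, blockVector_apply, hVb]
      ring
    refine (Finset.sum_le_sum fun j _ => h1 j).trans ?_
    rw [Finset.sum_const, Finset.card_univ, Fintype.card_fin, nsmul_eq_mul]
    exact mul_le_mul_of_nonneg_right (by exact_mod_cast Nat.sub_le k 1) (sq_nonneg _)
  · intro p q hpq
    -- The difference of two community indicators has squared norm 2m. At most half of this lies off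
    -- the selected eigenvectors, because 2ε² ≤ δ²; the inner products with the selected ones are m
    -- times the coordinates of the difference of the centres.
    set x : Fin k → ℝ := Pi.single p 1 - Pi.single q 1 with hx
    have hx0 : ∑ l, x l = 0 := by simp [hx]
    have hx2 : ∑ l, x l ^ 2 = 2 := by
      have : ∀ l, x l ^ 2 = (Pi.single p 1 : Fin k → ℝ) l + (Pi.single q 1 : Fin k → ℝ) l := by
        intro l
        by_cases hlp : l = p
        · subst hlp
          simp [hx, hpq]
        · by_cases hlq : l = q
          · subst hlq
            simp [hx, hlp]
          · simp [hx, hlp, hlq]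
      simp only [this]
      rw [Finset.sum_add_distrib]
      simp
      norm_num
    set u := blockVector σ x with hu
    have hun : ‖u‖ ^ 2 = 2 * m := by
      rw [hu, norm_sq_blockVector hσ, hx2]
      ring
    have hinner : ∀ j, inner ℝ (b (e j)) u =
        m * (centredMean σ m (b (e j)) p - centredMean σ m (b (e j)) q) := by
      intro j
      rw [real_inner_comm, hu, inner_blockVector]
      simp only [hx, Pi.sub_apply, sub_mul, Finset.sum_sub_distrib, Pi.single_apply, ite_mul,
        one_mul, zero_mul, Finset.sum_ite_eq', Finset.mem_univ, if_true, centredMean]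
      field_simp
      ring
    set R := Finset.univ.image e with hR
    have hsplit := Finset.sum_add_sum_compl R fun i => inner ℝ (b i) u ^ 2
    rw [← norm_sq_eq_sum_inner (b := b) u, hun] at hsplit
    have hsmall : δ ^ 2 * ∑ i ∈ Rᶜ, inner ℝ (b i) u ^ 2 ≤ ε ^ 2 * (2 * m) := by
      have h1 := pow_le_pow_left₀ (norm_nonneg _) (hU x hx0) 2
      rw [mul_pow, ← hu, hun, norm_sq_sub_smul_eq hb] at h1
      refine le_trans ?_ h1
      rw [Finset.mul_sum]
      refine (Finset.sum_le_sum fun i hi => ?_).trans (Finset.sum_le_sum_of_subset_of_nonneg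
        (Finset.subset_univ _) fun i _ _ => by positivity)
      refine mul_le_mul_of_nonneg_right ?_ (sq_nonneg _)
      rw [← sq_abs (ev i - c)]
      refine pow_le_pow_left₀ hδ.le (hfar i ?_) 2
      simpa [hR] using hi
    have hle : ∑ i ∈ Rᶜ, inner ℝ (b i) u ^ 2 ≤ m := by
      have : 0 < δ ^ 2 := by positivity
      nlinarith
    have hge : (m : ℝ) ≤ ∑ i ∈ R, inner ℝ (b i) u ^ 2 := by linarith
    rw [hR, Finset.sum_image fun _ _ _ _ h => e.injective h] at hge
    simp only [hinner, mul_pow] at hge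
    rw [← Finset.mul_sum] at hge
    rw [div_le_iff₀ hm']
    nlinarith

end Spectral

/-! ### Noise, mean matrix and Fourier coefficients of communities -/

section Matrices

variable {d k n m : ℕ} {F_in F_out : UnitAddTorus (Fin d) → ℝ}

theorem toEuclideanLin_coord (A : Matrix (Fin n) (Fin n) ℝ) (w : EuclideanSpace ℝ (Fin n))
    (i : Fin n) : Matrix.toEuclideanLin A w i = ∑ j, A i j * w j := rfl

theorem norm_sq_eq_sum_sq (w : EuclideanSpace ℝ (Fin n)) : ‖w‖ ^ 2 = ∑ i, w i ^ 2 := by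
  rw [EuclideanSpace.norm_sq_eq]
  simp

/-- The centred adjacency matrix. -/
def centredMatrix (p : Sym2 (Fin n) → ℝ) (G : SimpleGraph (Fin n)) : Matrix (Fin n) (Fin n) ℝ :=
  Matrix.of fun i j => centredEdge p G s(i, j)

/-- The conditional mean of the adjacency matrix. -/
def meanMatrix (p : Sym2 (Fin n) → ℝ) : Matrix (Fin n) (Fin n) ℝ :=
  Matrix.of fun i j => if i = j then 0 else p s(i, j)

open Classical in
theorem adjMatrix_eq_meanMatrix_add (p : Sym2 (Fin n) → ℝ) (G : SimpleGraph (Fin n)) :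
    G.adjMatrix ℝ = meanMatrix p + centredMatrix p G := by
  ext i j
  by_cases h : i = j
  · simp [meanMatrix, centredMatrix, centredEdge, vertexPairs, h]
  · simp [meanMatrix, centredMatrix, centredEdge, vertexPairs, h, SimpleGraph.adjMatrix_apply]

/-- Since Z is symmetric, ‖Zw‖² = ⟨w, Z²w⟩, and Cauchy–Schwarz over pairs of indices bounds this by
‖w‖²‖Z²‖_F. -/
theorem norm_centredMatrix_pow_le (p : Sym2 (Fin n) → ℝ) (G : SimpleGraph (Fin n))
    (w : EuclideanSpace ℝ (Fin n)) :
    ‖Matrix.toEuclideanLin (centredMatrix p G) w‖ ^ 4 ≤ noise p G * ‖w‖ ^ 4 := by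
  have h1 : ‖Matrix.toEuclideanLin (centredMatrix p G) w‖ ^ 2 =
      ∑ q : Fin n × Fin n, (w q.1 * w q.2) *
        ∑ i, centredEdge p G s(q.1, i) * centredEdge p G s(i, q.2) := by
    rw [norm_sq_eq_sum_sq, Fintype.sum_prod_type]
    simp only [toEuclideanLin_coord, centredMatrix, Matrix.of_apply, Finset.mul_sum]
    simp only [sq, Finset.sum_mul_sum]
    rw [Finset.sum_comm]
    refine Finset.sum_congr rfl fun j _ => ?_
    rw [Finset.sum_comm]
    refine Finset.sum_congr rfl fun l _ => Finset.sum_congr rfl fun i _ => ?_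
    rw [Sym2.eq_swap (a := i) (b := j)]
    ring
  have h2 := Finset.sum_mul_sq_le_sq_mul_sq (Finset.univ : Finset (Fin n × Fin n))
    (fun q => w q.1 * w q.2)
    (fun q => ∑ i, centredEdge p G s(q.1, i) * centredEdge p G s(i, q.2))
  rw [← h1] at h2
  have h3 : ∑ q : Fin n × Fin n, (w q.1 * w q.2) ^ 2 = ‖w‖ ^ 4 := by
    rw [show 4 = 2 * 2 from rfl, pow_mul, norm_sq_eq_sum_sq, sq (∑ i, w i ^ 2),
      Finset.sum_mul_sum, Fintype.sum_prod_type]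
    simp only [mul_pow]
  rw [h3, Fintype.sum_prod_type] at h2
  rw [show 4 = 2 * 2 from rfl, pow_mul, mul_comm]
  exact h2

theorem fourier_sub_apply (z : ℤ) (x y : UnitAddCircle) :
    fourier z (x - y) = fourier z x * fourier (-z) y := by
  have h : z • (x - y) = z • x + (-z) • y := by
    rw [smul_sub, neg_smul, sub_eq_add_neg]
  rw [fourier_apply, h, AddCircle.toCircle_add, Circle.coe_mul, fourier_apply, fourier_apply]

theorem mFourier_sub (z : Fin d → ℤ) (x y : UnitAddTorus (Fin d)) :
    UnitAddTorus.mFourier z (x - y) =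
      UnitAddTorus.mFourier z x * UnitAddTorus.mFourier (-z) y := by
  simp only [UnitAddTorus.mFourier, ContinuousMap.coe_mk, ← Finset.prod_mul_distrib]
  exact Finset.prod_congr rfl fun i _ => fourier_sub_apply (z i) (x i) (y i)

/-- The Fourier coefficient at `z` of the part of `w` in community `l`. -/
def blockFourier (σ : Fin n → Fin k) (X : Fin n → UnitAddTorus (Fin d))
    (w : EuclideanSpace ℝ (Fin n)) (z : Fin d → ℤ) (l : Fin k) : ℂ :=
  ∑ i ∈ community σ l, UnitAddTorus.mFourier (-z) (X i) * (w i : ℂ)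

theorem blockFourier_add (σ : Fin n → Fin k) (X : Fin n → UnitAddTorus (Fin d))
    (v w : EuclideanSpace ℝ (Fin n)) (z : Fin d → ℤ) (l : Fin k) :
    blockFourier σ X (v + w) z l = blockFourier σ X v z l + blockFourier σ X w z l := by
  simp [blockFourier, mul_add, Finset.sum_add_distrib]

theorem blockFourier_smul (σ : Fin n → Fin k) (X : Fin n → UnitAddTorus (Fin d)) (c : ℝ)
    (w : EuclideanSpace ℝ (Fin n)) (z : Fin d → ℤ) (l : Fin k) :
    blockFourier σ X (c • w) z l = c * blockFourier σ X w z l := by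
  simp [blockFourier, Finset.mul_sum, mul_left_comm]

theorem norm_blockFourier_le {σ : Fin n → Fin k} (hσ : Balanced m σ)
    (X : Fin n → UnitAddTorus (Fin d)) (w : EuclideanSpace ℝ (Fin n)) (z : Fin d → ℤ)
    (l : Fin k) : ‖blockFourier σ X w z l‖ ≤ Real.sqrt m * ‖w‖ := by
  have h1 : ‖blockFourier σ X w z l‖ ≤ ∑ i ∈ community σ l, |w i| := by
    refine (norm_sum_le _ _).trans (le_of_eq (Finset.sum_congr rfl fun i _ => ?_))
    rw [norm_mul, norm_mFourier_apply, one_mul, Complex.norm_real, Real.norm_eq_abs]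
  refine h1.trans ?_
  have h2 := sq_sum_le_card_mul_sum_sq (s := community σ l) (f := fun i => |w i|)
  rw [show (community σ l).card = m from hσ l] at h2
  have h3 : ∑ i ∈ community σ l, |w i| ^ 2 ≤ ‖w‖ ^ 2 := by
    rw [norm_sq_eq_sum_sq]
    simp only [sq_abs]
    exact Finset.sum_le_sum_of_subset_of_nonneg (Finset.subset_univ _) fun i _ _ => sq_nonneg _
  refine (pow_le_pow_iff_left₀ (Finset.sum_nonneg fun i _ => abs_nonneg _)
    (by positivity) two_ne_zero).1 ?_
  rw [mul_pow, Real.sq_sqrt (Nat.cast_nonneg m)]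
  exact h2.trans (mul_le_mul_of_nonneg_left h3 (Nat.cast_nonneg m))

/-- The character at X_i is the character at X_j times the character at X_i − X_j. Summing over i in
community l therefore leaves the empirical Fourier coefficient seen from j, which is m times the
true one plus `coeffDeviation`. -/
theorem blockFourier_meanMatrix (he_in : ∀ x, F_in (-x) = F_in x)
    (he_out : ∀ x, F_out (-x) = F_out x) (σ : Fin n → Fin k) (m : ℕ)
    (X : Fin n → UnitAddTorus (Fin d)) (w : EuclideanSpace ℝ (Fin n)) (z : Fin d → ℤ)
    (l : Fin k) :
    blockFourier σ X (Matrix.toEuclideanLin (meanMatrix (edgeProb F_in F_out σ X)) w) z l =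
      ∑ j, UnitAddTorus.mFourier (-z) (X j) * (w j : ℂ) *
        coeffDeviation F_in F_out σ m X z l j +
      m * ∑ l', connCoeff F_in F_out z l l' * blockFourier σ X w z l' := by
  classical
  have h1 : ∀ j, ∑ i ∈ community σ l, UnitAddTorus.mFourier (-z) (X i) *
      (meanMatrix (edgeProb F_in F_out σ X) i j : ℂ) =
      UnitAddTorus.mFourier (-z) (X j) * (coeffDeviation F_in F_out σ m X z l j +
        m * connCoeff F_in F_out z l (σ j)) := by
    intro j
    rw [coeffDeviation, sub_add_cancel, Finset.mul_sum]
    have h2 : ∀ i ∈ community σ l, UnitAddTorus.mFourier (-z) (X i) *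
        (meanMatrix (edgeProb F_in F_out σ X) i j : ℂ) = if i = j then 0 else
        UnitAddTorus.mFourier (-z) (X j) * ((connProb F_in F_out (X i - X j) l (σ j) : ℂ) *
          UnitAddTorus.mFourier (-z) (X i - X j)) := by
      intro i hi
      by_cases hij : i = j
      · simp [meanMatrix, hij]
      · rw [if_neg hij, meanMatrix, Matrix.of_apply, if_neg hij, edgeProb_mk he_in he_out,
          mem_community.1 hi, mFourier_sub, neg_neg]
        have h3 : UnitAddTorus.mFourier (-z) (X j) * UnitAddTorus.mFourier z (X j) = 1 := by
          rw [← UnitAddTorus.mFourier_add, neg_add_cancel, UnitAddTorus.mFourier_zero]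
          rfl
        linear_combination (-(UnitAddTorus.mFourier (-z) (X i)) *
          (connProb F_in F_out (X i - X j) l (σ j) : ℂ)) * h3
    rw [Finset.sum_congr rfl h2, ← Finset.filter_ne' (community σ l) j, Finset.sum_filter]
    refine Finset.sum_congr rfl fun i _ => ?_
    by_cases hij : i = j <;> simp [hij]
  have h4 : m * ∑ l', connCoeff F_in F_out z l l' * blockFourier σ X w z l' =
      ∑ j, UnitAddTorus.mFourier (-z) (X j) * (w j : ℂ) *
        (m * connCoeff F_in F_out z l (σ j)) := by
    simp only [blockFourier]
    rw [← sum_mul_eq_sum_community, Finset.mul_sum]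
    exact Finset.sum_congr rfl fun j _ => by ring
  rw [h4, ← Finset.sum_add_distrib]
  simp only [blockFourier, toEuclideanLin_coord, Complex.ofReal_sum, Complex.ofReal_mul,
    Finset.mul_sum]
  rw [Finset.sum_comm]
  refine Finset.sum_congr rfl fun j _ => ?_
  have h5 := congrArg (fun t => t * (w j : ℂ)) (h1 j)
  simp only [Finset.sum_mul] at h5
  rw [← mul_add]
  rw [mul_right_comm, ← h5]
  exact Finset.sum_congr rfl fun i _ => by ring

/-- Characters separate the variables of the truncated kernel, so it sees w only through
`blockFourier`. The diagonal is subtracted because M has zero diagonal, and the last sum is the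
truncation error. -/
theorem meanMatrix_apply_eq_series (he_in : ∀ x, F_in (-x) = F_in x)
    (he_out : ∀ x, F_out (-x) = F_out x) (σ : Fin n → Fin k) (S : Finset (Fin d → ℤ))
    (X : Fin n → UnitAddTorus (Fin d)) (w : EuclideanSpace ℝ (Fin n)) (i : Fin n) :
    (Matrix.toEuclideanLin (meanMatrix (edgeProb F_in F_out σ X)) w i : ℂ) =
      ∑ z ∈ S, UnitAddTorus.mFourier z (X i) *
        ∑ l, connCoeff F_in F_out z (σ i) l * blockFourier σ X w z l -
      connSeries F_in F_out S 0 (σ i) (σ i) * w i +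
      ∑ j, (if i = j then 0 else (connProb F_in F_out (X i - X j) (σ i) (σ j) : ℂ) -
        connSeries F_in F_out S (X i - X j) (σ i) (σ j)) * (w j : ℂ) := by
  classical
  have h1 : ∑ z ∈ S, UnitAddTorus.mFourier z (X i) *
      ∑ l, connCoeff F_in F_out z (σ i) l * blockFourier σ X w z l =
      ∑ j, connSeries F_in F_out S (X i - X j) (σ i) (σ j) * (w j : ℂ) := by
    simp only [blockFourier, connSeries, Finset.sum_mul]
    rw [Finset.sum_comm (s := Finset.univ)]
    refine Finset.sum_congr rfl fun z _ => ?_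
    rw [← sum_mul_eq_sum_community, Finset.mul_sum]
    refine Finset.sum_congr rfl fun j _ => ?_
    rw [mFourier_sub]
    ring
  have h2 : connSeries F_in F_out S 0 (σ i) (σ i) * (w i : ℂ) =
      ∑ j, if i = j then connSeries F_in F_out S (X i - X j) (σ i) (σ j) * (w j : ℂ) else 0 := by
    simp
  rw [h1, h2, ← Finset.sum_sub_distrib, ← Finset.sum_add_distrib, toEuclideanLin_coord,
    Complex.ofReal_sum]
  refine Finset.sum_congr rfl fun j _ => ?_
  rw [Complex.ofReal_mul, meanMatrix, Matrix.of_apply]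
  split_ifs
  · simp
  · rw [edgeProb_mk he_in he_out]
    ring

/-- A stable linear system for the Fourier coefficients of the communities. -/
theorem norm_le_of_blockSystem {f : Fin k → ℂ} {a b Δ : ℂ} {g E : ℝ} (hg : 0 < g) (hg1 : g ≤ 1)
    (hb : ‖b‖ ≤ 1) (hE : ∀ l, ‖(a - b - Δ) * f l + b * ∑ l', f l'‖ ≤ E)
    (h1 : g ≤ ‖a + ((k : ℂ) - 1) * b - Δ‖)
    (h2 : g ≤ ‖a - b - Δ‖ ∨ ∀ l l', f l = f l') (l : Fin k) :
    ‖f l‖ ≤ (1 + k / g) / g * E := by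
  have hE0 : 0 ≤ E := (norm_nonneg _).trans (hE l)
  have hsum : g * ‖∑ l', f l'‖ ≤ k * E := by
    -- Summing the equations isolates the eigenvalue on constant vectors. The sum being controlled,
    -- each f l follows by dividing by a − b − Δ, or from the sum alone when all f l are equal.
    have h3 : (a + ((k : ℂ) - 1) * b - Δ) * ∑ l', f l' =
        ∑ l, ((a - b - Δ) * f l + b * ∑ l', f l') := by
      rw [Finset.sum_add_distrib, ← Finset.mul_sum, Finset.sum_const, Finset.card_univ,
        Fintype.card_fin, nsmul_eq_mul]
      ring
    calc g * ‖∑ l', f l'‖ ≤ ‖a + ((k : ℂ) - 1) * b - Δ‖ * ‖∑ l', f l'‖ :=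
          mul_le_mul_of_nonneg_right h1 (norm_nonneg _)
      _ = ‖∑ l, ((a - b - Δ) * f l + b * ∑ l', f l')‖ := by rw [← norm_mul, h3]
      _ ≤ ∑ l : Fin k, E := (norm_sum_le _ _).trans (Finset.sum_le_sum fun l _ => hE l)
      _ = k * E := by simp
  have hsum' : ‖∑ l', f l'‖ ≤ k / g * E := by
    rw [div_mul_eq_mul_div, le_div_iff₀ hg]
    linarith
  rcases h2 with h2 | h2
  · have h4 : ‖(a - b - Δ) * f l‖ ≤ E + ‖∑ l', f l'‖ := by
      have h5 : (a - b - Δ) * f l = ((a - b - Δ) * f l + b * ∑ l', f l') - b * ∑ l', f l' := by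
        ring
      rw [h5]
      refine (norm_sub_le _ _).trans (add_le_add (hE l) ?_)
      rw [norm_mul]
      exact mul_le_of_le_one_left (norm_nonneg _) hb
    rw [norm_mul] at h4
    have h6 := mul_le_mul_of_nonneg_right h2 (norm_nonneg (f l))
    rw [div_mul_eq_mul_div, le_div_iff₀ hg]
    linarith
  · have hk : (1 : ℝ) ≤ k := by exact_mod_cast (Fin.pos l)
    have h7 : ‖∑ l', f l'‖ = k * ‖f l‖ := by
      rw [Finset.sum_congr rfl fun l' _ => h2 l' l]
      simp
    have h8 : ‖f l‖ ≤ k / g * E := by nlinarith [norm_nonneg (f l)]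
    refine h8.trans (mul_le_mul_of_nonneg_right ?_ hE0)
    rw [le_div_iff₀ hg]
    have : 0 ≤ (k : ℝ) / g := by positivity
    nlinarith

end Matrices

/-! ### Approximate eigenvectors and the spectral gap on regular graphs -/

section Recovery

variable {d k n m : ℕ} {F_in F_out : UnitAddTorus (Fin d) → ℝ}

open Classical in
theorem labelledNeighbors_eq_sum_adjMatrix (G : SimpleGraph (Fin n)) (σ : Fin n → Fin k)
    (v : Fin n) (l : Fin k) :
    (labelledNeighbors G σ v l : ℝ) = ∑ j ∈ community σ l, G.adjMatrix ℝ v j := by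
  simp only [SimpleGraph.adjMatrix_apply]
  rw [Finset.sum_boole, labelledNeighbors, community, Finset.filter_filter]
  simp only [and_comm]

open Classical in
/-- When the degrees concentrate, the centred block vectors are approximate eigenvectors. -/
theorem norm_adjMatrix_blockVector_sub_le {σ : Fin n → Fin k} (hσ : Balanced m σ)
    (hn : (n : ℝ) = k * m) {G : SimpleGraph (Fin n)} {ε : ℝ} (hε : 0 ≤ ε)
    (hdeg : ∀ v l,
      |(labelledNeighbors G σ v l : ℝ) - m * meanProb F_in F_out l (σ v)| ≤ ε * m)
    (x : Fin k → ℝ) (hx : ∑ l, x l = 0) :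
    ‖Matrix.toEuclideanLin (G.adjMatrix ℝ) (blockVector σ x) -
      ((density F_in - density F_out) * m) • blockVector σ x‖ ≤
        (k * ε * m) * ‖blockVector σ x‖ := by
  set Δ := density F_in - density F_out with hΔ
  have hcoord : ∀ i, (Matrix.toEuclideanLin (G.adjMatrix ℝ) (blockVector σ x) -
      (Δ * m) • blockVector σ x) i =
      ∑ l, x l * ((labelledNeighbors G σ i l : ℝ) - m * meanProb F_in F_out l (σ i)) := by
    intro i
    have h1 : Matrix.toEuclideanLin (G.adjMatrix ℝ) (blockVector σ x) i =
        ∑ l, x l * (labelledNeighbors G σ i l : ℝ) := by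
      rw [toEuclideanLin_coord]
      simp only [blockVector_apply, labelledNeighbors_eq_sum_adjMatrix]
      rw [← sum_mul_eq_sum_community]
      exact Finset.sum_congr rfl fun j _ => mul_comm _ _
    -- As the values of x sum to zero, the constant part μ_out of the mean probabilities cancels and
    -- only Δ on the diagonal remains.
    have h2 : ∑ l, x l * (m * meanProb F_in F_out l (σ i)) = Δ * m * x (σ i) := by
      have h3 : ∀ l, x l * (m * meanProb F_in F_out l (σ i)) =
          (if l = σ i then Δ * m * x l else 0) + m * density F_out * x l := by
        intro l
        unfold meanProb
        split_ifs
        · rw [hΔ]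
          ring
        · ring
      rw [Finset.sum_congr rfl fun l _ => h3 l, Finset.sum_add_distrib, ← Finset.mul_sum, hx]
      simp
    rw [PiLp.sub_apply, PiLp.smul_apply, smul_eq_mul, h1, blockVector_apply, ← h2,
      ← Finset.sum_sub_distrib]
    exact Finset.sum_congr rfl fun l _ => by ring
  refine (pow_le_pow_iff_left₀ (norm_nonneg _) (by positivity) two_ne_zero).1 ?_
  rw [norm_sq_eq_sum_sq, mul_pow, norm_sq_blockVector hσ]
  simp only [hcoord]
  have h4 : ∀ i, (∑ l, x l * ((labelledNeighbors G σ i l : ℝ) -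
      m * meanProb F_in F_out l (σ i))) ^ 2 ≤ (∑ l, x l ^ 2) * (k * (ε * m) ^ 2) := by
    intro i
    refine (Finset.sum_mul_sq_le_sq_mul_sq _ _ _).trans (mul_le_mul_of_nonneg_left ?_
      (Finset.sum_nonneg fun l _ => sq_nonneg _))
    calc _ ≤ ∑ l : Fin k, (ε * m) ^ 2 := Finset.sum_le_sum fun l _ => by
          rw [← sq_abs]
          exact pow_le_pow_left₀ (abs_nonneg _) (hdeg i l) 2
      _ = _ := by simp
  refine (Finset.sum_le_sum fun i _ => h4 i).trans (le_of_eq ?_)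
  rw [Finset.sum_const, Finset.card_univ, Fintype.card_fin, nsmul_eq_mul, hn]
  ring

theorem norm_sum_mul_coeffDeviation_le (σ : Fin n → Fin k) {S : Finset (Fin d → ℤ)}
    {X : Fin n → UnitAddTorus (Fin d)} {ν : ℝ} (hν : 0 ≤ ν)
    (hcoeff : ∑ z ∈ S, ∑ l, ∑ j, ‖coeffDeviation F_in F_out σ m X z l j‖ ^ 2 ≤ ν ^ 2 * m ^ 3)
    (w : EuclideanSpace ℝ (Fin n)) {z : Fin d → ℤ} (hz : z ∈ S) (l : Fin k) :
    ‖∑ j, UnitAddTorus.mFourier (-z) (X j) * (w j : ℂ) *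
      coeffDeviation F_in F_out σ m X z l j‖ ≤ ν * m * Real.sqrt m * ‖w‖ := by
  have h1 : ∑ j, ‖coeffDeviation F_in F_out σ m X z l j‖ ^ 2 ≤ ν ^ 2 * m ^ 3 := by
    refine le_trans ?_ hcoeff
    refine le_trans ?_ (Finset.single_le_sum (f := fun z => ∑ l, ∑ j,
      ‖coeffDeviation F_in F_out σ m X z l j‖ ^ 2) (fun z _ => by positivity) hz)
    exact Finset.single_le_sum (f := fun l => ∑ j, ‖coeffDeviation F_in F_out σ m X z l j‖ ^ 2)
      (fun l _ => by positivity) (Finset.mem_univ l)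
  have h2 : ‖∑ j, UnitAddTorus.mFourier (-z) (X j) * (w j : ℂ) *
      coeffDeviation F_in F_out σ m X z l j‖ ≤
      ∑ j, |w j| * ‖coeffDeviation F_in F_out σ m X z l j‖ := by
    refine (norm_sum_le _ _).trans (le_of_eq (Finset.sum_congr rfl fun j _ => ?_))
    rw [norm_mul, norm_mul, norm_mFourier_apply, one_mul, Complex.norm_real, Real.norm_eq_abs]
  refine h2.trans ((pow_le_pow_iff_left₀ (by positivity) (by positivity) two_ne_zero).1 ?_)
  refine (Finset.sum_mul_sq_le_sq_mul_sq _ _ _).trans ?_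
  simp only [sq_abs]
  rw [← norm_sq_eq_sum_sq, mul_pow, mul_pow, mul_pow, Real.sq_sqrt (Nat.cast_nonneg m)]
  calc _ ≤ ‖w‖ ^ 2 * (ν ^ 2 * m ^ 3) := mul_le_mul_of_nonneg_left h1 (sq_nonneg _)
    _ = _ := by ring

/-- The mean adjacency matrix is small on vectors with small Fourier coefficients. -/
theorem norm_sq_meanMatrix_le (h_in : ∀ x, F_in x ∈ Set.Icc (0 : ℝ) 1)
    (h_out : ∀ x, F_out x ∈ Set.Icc (0 : ℝ) 1) (he_in : ∀ x, F_in (-x) = F_in x)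
    (he_out : ∀ x, F_out (-x) = F_out x) (σ : Fin n → Fin k) (S : Finset (Fin d → ℤ))
    (X : Fin n → UnitAddTorus (Fin d)) (w : EuclideanSpace ℝ (Fin n)) {Q t : ℝ}
    (hQ : ∀ z ∈ S, ∀ l, ‖blockFourier σ X w z l‖ ≤ Q)
    (ht : ∑ i, ∑ j, seriesDeviation F_in F_out σ S X i j ≤ t) :
    ‖Matrix.toEuclideanLin (meanMatrix (edgeProb F_in F_out σ X)) w‖ ^ 2 ≤
      3 * (n * (S.card * (k * Q)) ^ 2 + S.card ^ 2 * ‖w‖ ^ 2 + ‖w‖ ^ 2 * t) := by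
  set h : Fin n → ℂ := fun i => ∑ j, (if i = j then 0 else
    (connProb F_in F_out (X i - X j) (σ i) (σ j) : ℂ) -
      connSeries F_in F_out S (X i - X j) (σ i) (σ j)) * (w j : ℂ) with hh
  have h1 : ∀ i, ‖h i‖ ^ 2 ≤ ‖w‖ ^ 2 * ∑ j, seriesDeviation F_in F_out σ S X i j := by
    intro i
    have h2 : ‖h i‖ ≤ ∑ j, |w j| * ‖(if i = j then 0 else
        (connProb F_in F_out (X i - X j) (σ i) (σ j) : ℂ) -
        connSeries F_in F_out S (X i - X j) (σ i) (σ j))‖ := by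
      refine (norm_sum_le _ _).trans (le_of_eq (Finset.sum_congr rfl fun j _ => ?_))
      rw [norm_mul, Complex.norm_real, Real.norm_eq_abs, mul_comm]
    refine (pow_le_pow_left₀ (norm_nonneg _) h2 2).trans
      ((Finset.sum_mul_sq_le_sq_mul_sq _ _ _).trans (le_of_eq ?_))
    simp only [sq_abs]
    rw [← norm_sq_eq_sum_sq]
    congr 1
    refine Finset.sum_congr rfl fun j _ => ?_
    unfold seriesDeviation
    split_ifs <;> simp
  have h3 : ∀ i, (Matrix.toEuclideanLin (meanMatrix (edgeProb F_in F_out σ X)) w i) ^ 2 ≤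
      3 * ((S.card * (k * Q)) ^ 2 + S.card ^ 2 * w i ^ 2 +
        ‖w‖ ^ 2 * ∑ j, seriesDeviation F_in F_out σ S X i j) := by
    intro i
    have h4 := congrArg norm (meanMatrix_apply_eq_series he_in he_out σ S X w i)
    rw [Complex.norm_real, Real.norm_eq_abs] at h4
    have h5 : ‖∑ z ∈ S, UnitAddTorus.mFourier z (X i) *
        ∑ l, connCoeff F_in F_out z (σ i) l * blockFourier σ X w z l‖ ≤ S.card * (k * Q) := by
      refine (norm_sum_le _ _).trans ((Finset.sum_le_sum (g := fun _ => k * Q)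
        fun z hz => ?_).trans (le_of_eq (by simp)))
      rw [norm_mul, norm_mFourier_apply, one_mul]
      refine (norm_sum_le _ _).trans ((Finset.sum_le_sum (g := fun _ => Q)
        fun l _ => ?_).trans (le_of_eq (by simp)))
      rw [norm_mul]
      exact (mul_le_of_le_one_left (norm_nonneg _) (norm_connCoeff_le h_in h_out _ _ _)).trans
        (hQ z hz l)
    have h6 : ‖connSeries F_in F_out S 0 (σ i) (σ i) * (w i : ℂ)‖ ≤ S.card * |w i| := by
      rw [norm_mul, Complex.norm_real, Real.norm_eq_abs]
      exact mul_le_mul_of_nonneg_right (norm_connSeries_le h_in h_out S _ _ _) (abs_nonneg _)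
    -- Truncated kernel, diagonal correction and truncation error; the factor 3 comes from (a + b +
    -- c)² ≤ 3(a² + b² + c²).
    have h7 : |Matrix.toEuclideanLin (meanMatrix (edgeProb F_in F_out σ X)) w i| ≤
        S.card * (k * Q) + S.card * |w i| + ‖h i‖ := by
      rw [h4]
      exact (norm_add_le _ _).trans (add_le_add ((norm_sub_le _ _).trans (add_le_add h5 h6)) le_rfl)
    have h8 := pow_le_pow_left₀ (abs_nonneg _) h7 2
    rw [sq_abs] at h8
    have h9 := h1 i
    have h10 : ((S.card : ℝ) * |w i|) ^ 2 = S.card ^ 2 * w i ^ 2 := by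
      rw [mul_pow, sq_abs]
    nlinarith [sq_nonneg (S.card * (k * Q) - S.card * |w i|),
      sq_nonneg (S.card * (k * Q) - ‖h i‖), sq_nonneg (S.card * |w i| - ‖h i‖)]
  rw [norm_sq_eq_sum_sq]
  refine (Finset.sum_le_sum fun i _ => h3 i).trans ?_
  rw [← Finset.mul_sum, Finset.sum_add_distrib, Finset.sum_add_distrib, Finset.sum_const,
    Finset.card_univ, Fintype.card_fin, nsmul_eq_mul, ← Finset.mul_sum, ← Finset.mul_sum,
    ← norm_sq_eq_sum_sq]
  have := mul_le_mul_of_nonneg_left ht (sq_nonneg ‖w‖)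
  linarith

theorem sum_connCoeff_mul (z : Fin d → ℤ) (l : Fin k) (f : Fin k → ℂ) :
    ∑ l', connCoeff F_in F_out z l l' * f l' =
      (fourierCoeff F_in z - fourierCoeff F_out z) * f l + fourierCoeff F_out z * ∑ l', f l' := by
  have h : ∀ l', connCoeff F_in F_out z l l' * f l' =
      (if l = l' then (fourierCoeff F_in z - fourierCoeff F_out z) * f l' else 0) +
        fourierCoeff F_out z * f l' := by
    intro l'
    unfold connCoeff
    split_ifs <;> ring
  rw [Finset.sum_congr rfl fun l' _ => h l', Finset.sum_add_distrib, ← Finset.mul_sum]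
  simp

open Classical in
/-- Under the spectral gap conditions, a regular graph has no approximate eigenvector for the
eigenvalue of interest that is orthogonal to the centred block vectors. -/
theorem le_norm_adjMatrix_sub_of_isRegular (h_in : ∀ x, F_in x ∈ Set.Icc (0 : ℝ) 1)
    (h_out : ∀ x, F_out x ∈ Set.Icc (0 : ℝ) 1) (he_in : ∀ x, F_in (-x) = F_in x)
    (he_out : ∀ x, F_out (-x) = F_out x) (hμ : density F_out < density F_in)
    {σ : Fin n → Fin k} (hσ : Balanced m σ) (hm : 0 < m) (hn : (n : ℝ) = k * m)
    {S : Finset (Fin d → ℤ)} {X : Fin n → UnitAddTorus (Fin d)} {G : SimpleGraph (Fin n)}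
    {ν ε g : ℝ} (hν : 0 < ν) (hνΔ : ν ≤ (density F_in - density F_out) / 4)
    (hg : 0 < g) (hg1 : g ≤ 1)
    (hgap₁ : ∀ z ∈ S, g ≤ ‖fourierCoeff F_in z + ((k : ℂ) - 1) * fourierCoeff F_out z -
      ((density F_in - density F_out : ℝ) : ℂ)‖)
    (hgap₂ : ∀ z ∈ S, z ≠ 0 → g ≤ ‖fourierCoeff F_in z - fourierCoeff F_out z -
      ((density F_in - density F_out : ℝ) : ℂ)‖)
    (hνS : 3 * (k * (S.card * (k * ((1 + k / g) / g * (3 * ν)))) ^ 2) ≤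
      (density F_in - density F_out) ^ 2 / 64)
    (hmS : 3 * (S.card : ℝ) ^ 2 ≤ (density F_in - density F_out) ^ 2 / 64 * m ^ 2)
    (hreg : IsRegular F_in F_out σ m S ((ν * m) ^ 4)
      (((density F_in - density F_out) * m / 4) ^ 2) (ν ^ 2 * m ^ 3) ε X G)
    (w : EuclideanSpace ℝ (Fin n))
    (hw : ∀ l l', ∑ i ∈ community σ l, w i = ∑ i ∈ community σ l', w i) :
    (ν * m) * ‖w‖ ≤ ‖Matrix.toEuclideanLin (G.adjMatrix ℝ) w -
      ((density F_in - density F_out) * m) • w‖ := by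
  set Δ := density F_in - density F_out with hΔ
  have hΔ0 : 0 < Δ := sub_pos.2 hμ
  have hm' : (0 : ℝ) < m := Nat.cast_pos.2 hm
  by_contra hlt
  push Not at hlt
  set N := ‖w‖ with hN
  have hN0 : 0 < N := by
    by_contra h
    have : N = 0 := le_antisymm (not_lt.1 h) (norm_nonneg _)
    rw [this, mul_zero] at hlt
    exact absurd hlt (not_lt.2 (norm_nonneg _))
  set p := edgeProb F_in F_out σ X with hp
  set r := Matrix.toEuclideanLin (G.adjMatrix ℝ) w - (Δ * m) • w with hr
  set M := Matrix.toEuclideanLin (meanMatrix p) w with hM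
  set Z := Matrix.toEuclideanLin (centredMatrix p G) w with hZ
  have hMZ : M + Z = (Δ * m) • w + r := by
    rw [hr, add_sub_cancel, adjMatrix_eq_meanMatrix_add p G, map_add, LinearMap.add_apply]
  have hZle : ‖Z‖ ≤ ν * m * N := by
    refine (pow_le_pow_iff_left₀ (norm_nonneg _) (by positivity) (four_ne_zero)).1 ?_
    rw [mul_pow]
    exact (norm_centredMatrix_pow_le p G w).trans
      (mul_le_mul_of_nonneg_right hreg.noise_lt.le (by positivity))
  -- Fourier coefficients of M w = Δm w + r − Z w, where `M` and `Z` name the images of w. The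
  -- residual r, the noise and the coefficient deviation each contribute νm√m‖w‖; division by m
  -- leaves 3ν.
  have hsys : ∀ z ∈ S, ∀ l, ‖(fourierCoeff F_in z - fourierCoeff F_out z - (Δ : ℂ)) *
      blockFourier σ X w z l + fourierCoeff F_out z * ∑ l', blockFourier σ X w z l'‖ ≤
      3 * ν * (Real.sqrt m * N) := by
    intro z hz l
    have h1 := congrArg (fun v => blockFourier σ X v z l) hMZ
    simp only [blockFourier_add, blockFourier_smul] at h1
    rw [hM, hp, blockFourier_meanMatrix he_in he_out σ m X w z l, sum_connCoeff_mul] at h1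
    have h2 : (m : ℂ) * ((fourierCoeff F_in z - fourierCoeff F_out z - (Δ : ℂ)) *
        blockFourier σ X w z l + fourierCoeff F_out z * ∑ l', blockFourier σ X w z l') =
        blockFourier σ X r z l - blockFourier σ X Z z l -
        ∑ j, UnitAddTorus.mFourier (-z) (X j) * (w j : ℂ) *
          coeffDeviation F_in F_out σ m X z l j := by
      push_cast at h1
      linear_combination h1
    have h3 := congrArg norm h2
    rw [norm_mul, Complex.norm_natCast] at h3
    have h4 := (norm_sub_le (blockFourier σ X r z l - blockFourier σ X Z z l)
      (∑ j, UnitAddTorus.mFourier (-z) (X j) * (w j : ℂ) *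
          coeffDeviation F_in F_out σ m X z l j)).trans
      (add_le_add (norm_sub_le _ _)
        (norm_sum_mul_coeffDeviation_le σ hν.le hreg.coeff_lt.le w hz l))
    rw [← h3] at h4
    have h5 := (norm_blockFourier_le hσ X r z l).trans
      (mul_le_mul_of_nonneg_left hlt.le (Real.sqrt_nonneg m))
    have h6 := (norm_blockFourier_le hσ X Z z l).trans
      (mul_le_mul_of_nonneg_left hZle (Real.sqrt_nonneg m))
    refine le_of_mul_le_mul_left ?_ hm'
    refine h4.trans ((add_le_add (add_le_add h5 h6) le_rfl).trans (le_of_eq ?_))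
    rw [← hN]
    ring
  set C := (1 + k / g) / g with hC
  have hC0 : 0 ≤ C := by positivity
  have hQ : ∀ z ∈ S, ∀ l, ‖blockFourier σ X w z l‖ ≤ C * (3 * ν * (Real.sqrt m * N)) := by
    intro z hz l
    refine norm_le_of_blockSystem hg hg1 (norm_fourierCoeff_le h_out z) (hsys z hz) (hgap₁ z hz)
      ?_ l
    -- At z = 0 the number F̂_in − F̂_out is Δ itself, and the second alternative is supplied by the
    -- equal community sums of w.
    by_cases hz0 : z = 0
    · right
      intro l l'
      have h1 : ∀ l, blockFourier σ X w z l = ((∑ i ∈ community σ l, w i : ℝ) : ℂ) := by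
        intro l
        simp [blockFourier, hz0, UnitAddTorus.mFourier_zero]
      rw [h1, h1, hw l l']
    · exact Or.inl (hgap₂ z hz hz0)
  have hMle := norm_sq_meanMatrix_le h_in h_out he_in he_out σ S X w hQ
    hreg.series_lt.le
  rw [← hp, ← hM, ← hN, hn] at hMle
  have hMge : Δ / 2 * m * N ≤ ‖M‖ := by
    have h1 : (Δ * m) • w = M + Z - r := by rw [hMZ, add_sub_cancel_right]
    have h2 : Δ * m * N = ‖M + Z - r‖ := by
      rw [← h1, norm_smul, Real.norm_of_nonneg (by positivity)]
    have h3 := (norm_sub_le (M + Z) r).trans (add_le_add (norm_add_le M Z) le_rfl)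
    have h4 : ν * (m * N) ≤ Δ / 4 * (m * N) :=
      mul_le_mul_of_nonneg_right hνΔ (by positivity)
    linarith
  have hMge' := pow_le_pow_left₀ (by positivity) hMge 2
  have h1 : (k * m : ℝ) * (S.card * (k * (C * (3 * ν * (Real.sqrt m * N))))) ^ 2 =
      k * (S.card * (k * (C * (3 * ν)))) ^ 2 * (m ^ 2 * N ^ 2) := by
    have : (S.card * (k * (C * (3 * ν * (Real.sqrt m * N)))) : ℝ) =
        S.card * (k * (C * (3 * ν))) * N * Real.sqrt m := by ring
    rw [this, mul_pow _ (Real.sqrt m), Real.sq_sqrt hm'.le]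
    ring
  rw [h1] at hMle
  -- In units of Δ²m²N², the upper bound for ‖M‖² is 1/64 + 1/64 + 3/16 = 7/32, below the lower
  -- bound 1/4.
  have hmN : 0 < (m : ℝ) ^ 2 * N ^ 2 := by positivity
  have h2 := mul_le_mul_of_nonneg_right hνS hmN.le
  have h3 := mul_le_mul_of_nonneg_right hmS (sq_nonneg N)
  have h4 : 0 < Δ ^ 2 * ((m : ℝ) ^ 2 * N ^ 2) := by positivity
  nlinarith

end Recovery

/-! ### Choice of constants and conclusion -/

section Consistency

variable {d k : ℕ} {F_in F_out : UnitAddTorus (Fin d) → ℝ}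

/-- On a regular graph every output of the improved algorithm is exact. -/
theorem loss_eq_zero_of_isRegular (hk : 2 ≤ k) (h_in : ∀ x, F_in x ∈ Set.Icc (0 : ℝ) 1)
    (h_out : ∀ x, F_out x ∈ Set.Icc (0 : ℝ) 1) (he_in : ∀ x, F_in (-x) = F_in x)
    (he_out : ∀ x, F_out (-x) = F_out x) (hμ : density F_out < density F_in)
    {m : ℕ} {σ τ : Fin (k * m) → Fin k} (hσ : Balanced m σ) (hm : 0 < m)
    {S : Finset (Fin d → ℤ)} {X : Fin (k * m) → UnitAddTorus (Fin d)}
    {G : SimpleGraph (Fin (k * m))} {ν ε g η : ℝ} (hη : 0 ≤ η) (hν : 0 < ν)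
    (hνΔ : ν ≤ (density F_in - density F_out) / 4)
    (hg : 0 < g) (hg1 : g ≤ 1)
    (hgap₁ : ∀ z ∈ S, g ≤ ‖fourierCoeff F_in z + ((k : ℂ) - 1) * fourierCoeff F_out z -
      ((density F_in - density F_out : ℝ) : ℂ)‖)
    (hgap₂ : ∀ z ∈ S, z ≠ 0 → g ≤ ‖fourierCoeff F_in z - fourierCoeff F_out z -
      ((density F_in - density F_out : ℝ) : ℂ)‖)
    (hνS : 3 * (k * (S.card * (k * ((1 + k / g) / g * (3 * ν)))) ^ 2) ≤
      (density F_in - density F_out) ^ 2 / 64)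
    (hmS : 3 * (S.card : ℝ) ^ 2 ≤ (density F_in - density F_out) ^ 2 / 64 * m ^ 2)
    (hε : 0 ≤ ε) (hεν : 2 * (k * ε) ^ 2 ≤ ν ^ 2)
    (hε1 : 8 * (2 + η) * (k * (2 * (k * ε) / ν) ^ 2) < 1)
    (hεΔ : 2 * ε + 2 * (8 * (2 + η) * (k * (2 * (k * ε) / ν) ^ 2)) <
      density F_in - density F_out)
    (hreg : IsRegular F_in F_out σ m S ((ν * m) ^ 4)
      (((density F_in - density F_out) * m / 4) ^ 2) (ν ^ 2 * m ^ 3) ε X G)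
    (hτ : IsImprovedOutput η (density F_in) (density F_out) G τ) : loss σ τ = 0 := by
  have hm' : (0 : ℝ) < m := Nat.cast_pos.2 hm
  have hk' : (0 : ℝ) < k := Nat.cast_pos.2 (by omega)
  have hn : ((k * m : ℕ) : ℝ) = k * m := by push_cast; ring
  obtain ⟨τ₀, ⟨V, hV, hτ₀⟩, hτ⟩ := hτ
  have hc : (density F_in - density F_out) / k * ((k * m : ℕ) : ℝ) =
      (density F_in - density F_out) * m := by
    rw [hn]
    field_simp
  rw [hc] at hV
  obtain ⟨Y, hY, hsep⟩ := exists_centres_of_isClosestEigenvectors hk hσ hm hV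
    (ε := k * ε * m) (δ := ν * m) (by positivity) (by positivity)
    (by nlinarith [mul_le_mul_of_nonneg_right hεν (sq_nonneg (m : ℝ))])
    (norm_adjMatrix_blockVector_sub_le hσ hn hε hreg.degree_le)
    (le_norm_adjMatrix_sub_of_isRegular h_in h_out he_in he_out hμ hσ hm hn hν hνΔ hg hg1 hgap₁
      hgap₂ hνS hmS hreg)
  have h1 : 2 * (k * ε * m) / (ν * m) = 2 * (k * ε) / ν := by
    field_simp
  rw [h1] at hY
  obtain ⟨π, hπ⟩ := exists_perm_of_isApproxKMeans hσ hm Y hη hY hsep hτ₀ hε1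
  exact loss_eq_zero_of_isLocalImprovement hm hreg.degree_le π hπ hεΔ hτ

theorem exists_pos_le_of_forall_pos {ι : Type*} (S : Finset ι) (f : ι → ℝ)
    (hf : ∀ z ∈ S, 0 < f z) : ∃ g, 0 < g ∧ g ≤ 1 ∧ ∀ z ∈ S, g ≤ f z := by
  classical
  induction S using Finset.induction_on with
  | empty => exact ⟨1, one_pos, le_rfl, by simp⟩
  | insert a S _ ih =>
    obtain ⟨g, hg, hg1, h⟩ := ih fun z hz => hf z (Finset.mem_insert_of_mem hz)
    refine ⟨min g (f a), lt_min hg (hf a (Finset.mem_insert_self a S)),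
      (min_le_left _ _).trans hg1, fun z hz => ?_⟩
    rcases Finset.mem_insert.1 hz with rfl | hz
    · exact min_le_right _ _
    · exact (min_le_left _ _).trans (h z hz)

/-- A continuous quantity vanishing at zero is small for some small positive argument. -/
theorem exists_pos_of_continuous {f : ℝ → ℝ} (hf : Continuous f) (h0 : f 0 = 0) {a b : ℝ}
    (ha : 0 < a) (hb : 0 < b) : ∃ x, 0 < x ∧ x ≤ a ∧ f x < b := by
  have h1 : ∀ᶠ x in nhdsWithin (0 : ℝ) (Set.Ioi 0), f x < b :=
    (hf.tendsto 0).eventually (gt_mem_nhds (by rw [h0]; exact hb)) |>.filter_mono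
      nhdsWithin_le_nhds
  have h2 : ∀ᶠ x in nhdsWithin (0 : ℝ) (Set.Ioi 0), x ∈ Set.Ioc 0 a :=
    Ioc_mem_nhdsGT ha
  obtain ⟨x, h, hx⟩ := (h1.and h2).exists
  exact ⟨x, hx.1, hx.2, h⟩

/-- The failure probability bound is eventually small. -/
theorem eventually_failure_bound_le {k s : ℕ} (hk : 0 < k) {ν Δ ε ρ : ℝ} (hν : 0 < ν)
    (hΔ : 0 < Δ) (hε : 0 < ε) (hρ : 0 < ρ) :
    ∀ᶠ m : ℕ in Filter.atTop,
      2 * ((k * m : ℕ) : ℝ) ^ 3 / (ν * m) ^ 4 +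
        ((k * m : ℕ) : ℝ) ^ 2 * (ρ * Δ ^ 2 / (32 * k ^ 2)) / (Δ * m / 4) ^ 2 +
        s * (k * ((k * m : ℕ) * (8 * m + 2))) / (ν ^ 2 * m ^ 3) +
        (k * m : ℕ) * (k * (2 * Real.exp (1 - m * (ε ^ 2 / 4)))) ≤ ρ := by
  have hk' : (0 : ℝ) < k := Nat.cast_pos.2 hk
  have h1 : Filter.Tendsto (fun m : ℕ => (m : ℝ)⁻¹) Filter.atTop (nhds 0) :=
    tendsto_inv_atTop_nhds_zero_nat
  have h2 : Filter.Tendsto (fun m : ℕ => (m : ℝ) ^ 1 * Real.exp (-(ε ^ 2 / 4) * m)) Filter.atTop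
      (nhds 0) := by
    have := (Real.tendsto_pow_mul_exp_neg_atTop_nhds_zero 1).comp
      ((tendsto_natCast_atTop_atTop (R := ℝ)).const_mul_atTop (by positivity : 0 < ε ^ 2 / 4))
    have h3 := this.const_mul (ε ^ 2 / 4)⁻¹
    rw [mul_zero] at h3
    refine h3.congr fun m => ?_
    simp only [Function.comp_apply, pow_one, neg_mul]
    field_simp
  -- The series term does not decay in m for fixed S: the tolerance ρΔ²/(32k²) makes it exactly ρ/2.
  -- The other three terms tend to zero.
  have h3 : Filter.Tendsto (fun m : ℕ => 2 * (k : ℝ) ^ 3 / ν ^ 4 * (m : ℝ)⁻¹ + ρ / 2 +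
      s * k ^ 2 * 10 / ν ^ 2 * (m : ℝ)⁻¹ +
      k ^ 2 * 2 * Real.exp 1 * ((m : ℝ) ^ 1 * Real.exp (-(ε ^ 2 / 4) * m))) Filter.atTop
      (nhds (ρ / 2)) := by
    have := (((h1.const_mul (2 * (k : ℝ) ^ 3 / ν ^ 4)).add_const (ρ / 2)).add
      (h1.const_mul (s * k ^ 2 * 10 / ν ^ 2 : ℝ))).add (h2.const_mul (k ^ 2 * 2 * Real.exp 1 : ℝ))
    simpa using this
  filter_upwards [h3.eventually (gt_mem_nhds (half_lt_self hρ)), Filter.eventually_ge_atTop 1]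
    with m hm hm1
  have hm' : (1 : ℝ) ≤ m := by exact_mod_cast hm1
  have hm0 : (0 : ℝ) < m := by linarith
  refine le_trans (add_le_add (add_le_add (add_le_add ?_ ?_) ?_) ?_) hm.le
  · push_cast
    refine le_of_eq ?_
    field_simp
  · push_cast
    refine le_of_eq ?_
    field_simp
    ring
  · push_cast
    have h4 : (s : ℝ) * (k * (k * m * (8 * m + 2))) ≤ s * (k * (k * m * (10 * m))) := by
      gcongr
      linarith
    refine (div_le_div_of_nonneg_right h4 (by positivity)).trans (le_of_eq ?_)
    field_simp
  · push_cast
    refine le_of_eq ?_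
    rw [sub_eq_add_neg, Real.exp_add]
    have : -((m : ℝ) * (ε ^ 2 / 4)) = -(ε ^ 2 / 4) * m := by ring
    rw [this]
    ring

end Consistency
end SGBM

end

open SGBM in
theorem mainTheorem6 (d k : ℕ) (hk : 2 ≤ k) (F_in F_out : UnitAddTorus (Fin d) → ℝ)
    (hF_in_meas : Measurable F_in) (hF_out_meas : Measurable F_out)
    (hF_in_range : ∀ x, F_in x ∈ Set.Icc (0 : ℝ) 1) (hF_out_range : ∀ x, F_out x ∈ Set.Icc (0 : ℝ) 1)
    (hF_in_even : ∀ x, F_in (-x) = F_in x) (hF_out_even : ∀ x, F_out (-x) = F_out x)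
    (hμ : density F_out < density F_in) (hμout : 0 < density F_out)
    (h_ii : ∀ z : Fin d → ℤ, fourierCoeff F_in z + ((k : ℂ) - 1) * fourierCoeff F_out z ≠
      ((density F_in - density F_out : ℝ) : ℂ))
    (h_iii : ∀ z : Fin d → ℤ, z ≠ 0 → fourierCoeff F_in z - fourierCoeff F_out z ≠
      ((density F_in - density F_out : ℝ) : ℂ))
    (σ : ∀ m : ℕ, Fin (k * m) → Fin k) (hσ : ∀ m, Balanced m (σ m))
    (η : ℝ) (hη : 0 ≤ η) :
    Filter.Tendsto
      (fun m : ℕ => law F_in F_out (σ m)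
        {G | ∃ τ : Fin (k * m) → Fin k,
          IsImprovedOutput η (density F_in) (density F_out) G τ ∧ 0 < loss (σ m) τ})
      Filter.atTop (nhds 0) := by
  classical
  have hΔ : 0 < density F_in - density F_out := sub_pos.2 hμ
  have hk0 : (0 : ℝ) < k := Nat.cast_pos.2 (by omega)
  rw [ENNReal.tendsto_nhds_zero]
  intro r hr
  obtain ⟨ρ, hρ, hρr⟩ : ∃ ρ : ℝ, 0 < ρ ∧ ENNReal.ofReal ρ ≤ r := by
    obtain ⟨q, hq0, hq⟩ := ENNReal.lt_iff_exists_nnreal_btwn.1 hr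
    exact ⟨q, by exact_mod_cast hq0, by rw [ENNReal.ofReal_coe_nnreal]; exact hq.le⟩
  -- The order of choice matters: ρ determines S, S the gap g, then ν depends on S and g, ε on ν,
  -- and finally m is taken large.
  have hε' : 0 < ρ * (density F_in - density F_out) ^ 2 / (32 * (k : ℝ) ^ 2) := by positivity
  obtain ⟨S, hS_in, hS_out⟩ :=
    ((eventually_integral_sq_fourierPartialSum_le hF_in_meas hF_in_range hε').and
      (eventually_integral_sq_fourierPartialSum_le hF_out_meas hF_out_range hε')).exists
  obtain ⟨g, hg, hg1, hgap⟩ := exists_pos_le_of_forall_pos S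
    (fun z => min ‖fourierCoeff F_in z + ((k : ℂ) - 1) * fourierCoeff F_out z -
      ((density F_in - density F_out : ℝ) : ℂ)‖
      (if z = 0 then 1 else ‖fourierCoeff F_in z - fourierCoeff F_out z -
      ((density F_in - density F_out : ℝ) : ℂ)‖)) (by
        intro z _
        refine lt_min (norm_pos_iff.2 (sub_ne_zero.2 (h_ii z))) ?_
        split_ifs with hz
        · exact one_pos
        · exact norm_pos_iff.2 (sub_ne_zero.2 (h_iii z hz)))
  have hgap₁ := fun z hz => (hgap z hz).trans (min_le_left _ _)
  have hgap₂ : ∀ z ∈ S, z ≠ 0 → g ≤ ‖fourierCoeff F_in z - fourierCoeff F_out z -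
      ((density F_in - density F_out : ℝ) : ℂ)‖ := fun z hz hz0 => by
    simpa [hz0] using (hgap z hz).trans (min_le_right _ _)
  obtain ⟨ν, hν, hνΔ, hνS⟩ := exists_pos_of_continuous
    (f := fun ν => 3 * (k * (S.card * (k * ((1 + k / g) / g * (3 * ν)))) ^ 2))
    (by fun_prop) (by simp)
    (by positivity : 0 < (density F_in - density F_out) / 4)
    (by positivity : 0 < (density F_in - density F_out) ^ 2 / 64)
  -- Three smallness conditions on ε are packed into one sum of nonnegative terms below 1, so that
  -- each term is below 1.
  obtain ⟨ε, hε, hε1, hεb⟩ := exists_pos_of_continuous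
    (f := fun ε => 2 * (k * ε) ^ 2 / ν ^ 2 + 8 * (2 + η) * (k * (2 * (k * ε) / ν) ^ 2) +
      (2 * ε + 2 * (8 * (2 + η) * (k * (2 * (k * ε) / ν) ^ 2))) / (density F_in - density F_out))
    (by fun_prop) (by simp) one_pos one_pos
  have hε₁ : 0 ≤ 2 * (k * ε) ^ 2 / ν ^ 2 := by positivity
  have hε₂ : 0 ≤ 8 * (2 + η) * (k * (2 * (k * ε) / ν) ^ 2) := by positivity
  have hε₃ : 0 ≤ (2 * ε + 2 * (8 * (2 + η) * (k * (2 * (k * ε) / ν) ^ 2))) /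
    (density F_in - density F_out) := by positivity
  have hεν : 2 * (k * ε) ^ 2 ≤ ν ^ 2 := by
    have : 2 * (k * ε) ^ 2 / ν ^ 2 ≤ 1 := by linarith
    rwa [div_le_one (by positivity)] at this
  have hεΔ : 2 * ε + 2 * (8 * (2 + η) * (k * (2 * (k * ε) / ν) ^ 2)) <
      density F_in - density F_out := by
    rw [← div_lt_one hΔ]
    linarith
  have hmS : ∀ᶠ m : ℕ in Filter.atTop,
      3 * (S.card : ℝ) ^ 2 ≤ (density F_in - density F_out) ^ 2 / 64 * (m : ℝ) ^ 2 :=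
    (((Filter.tendsto_pow_atTop two_ne_zero).comp
      (tendsto_natCast_atTop_atTop (R := ℝ))).const_mul_atTop
      (by positivity)).eventually_ge_atTop _
  filter_upwards [hmS, Filter.eventually_gt_atTop 0,
    eventually_failure_bound_le (k := k) (s := S.card) (by omega) hν hΔ hε hρ] with m hmS hm hbound
  refine (law_le_of_not_isRegular hF_in_meas hF_out_meas hF_in_range hF_out_range hF_in_even
    hF_out_even (hσ m) (t₁ := (ν * m) ^ 4) (t₂ := ((density F_in - density F_out) * m / 4) ^ 2)
    (t₃ := ν ^ 2 * m ^ 3) (by positivity) (by positivity) (by positivity) hε hε1 hε'.le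
    hS_in hS_out _ ?_).trans ((ENNReal.ofReal_le_ofReal hbound).trans hρr)
  rintro G ⟨τ, hτ, hloss⟩ X hreg
  exact hloss.ne' (loss_eq_zero_of_isRegular hk hF_in_range hF_out_range hF_in_even hF_out_even hμ
    (hσ m) hm hη hν hνΔ hg hg1 hgap₁ hgap₂ hνS.le hmS hε.le hεν (by linarith) hεΔ hreg hτ)
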